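/- Let $\mathbb{R}^{2n}$ carry coordinates $(q,p)$, the Euclidean inner product, the symplectic form $\omega=\sum_i dp_i\wedge dq_i$ and $J(q,p)=(p,-q)$. Let $K\subset\mathbb{R}^{2n}$ be a convex body (compact, convex, with non-empty interior). For $x\in\partial K$ let $N_K(x)=\{v:\langle v,x-y\rangle\ge 0\ \forall y\in K\}$ be the normal cone, and for $E\subset\partial K$ put $N_K(E)=\bigcap_{x\in E}N_K(x)$. A closed characteristic on $\partial K$ is a non-constant curve $\gamma\in W^{1,2}([0,T],\partial K)$, $T>0$, with $\gamma(0)=\gamma(T)$ and $-J\dot\gamma(t)\in N_K(\gamma(t))$ for almost every $t$; its action is $\frac12\int_0^T\sum_i(p_i\dot q_i-q_i\dot p_i)\,dt$, and it is action-minimizing if no closed characteristic on $\partial K$ (of any period) has smaller action. An extreme face of $N_K(x)$ is a set $F=L\cap N_K(x)$, with $L$ a linear subspace, that is an extreme subset of $N_K(x)$ (if a point of $F$ lies in an open segment with endpoints in $N_K(x)$, then the endpoints lie in $F$); its dimension is that of its linear span, it is isotropic if $\omega$ vanishes on its span, and it is an extreme ray if it is one-dimensional. A coisotropic face of $\partial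 K$ is an extreme convex subset $E$ of $\partial K$ such that $\mathrm{span}(E-E)$ is coisotropic, i.e. contains its $\omega$-orthogonal complement. The curve $\gamma$ moves along the coisotropic face $E$ at time $t$ if there is an open interval $(t_0,t_1)\ni t$ of times such that $\gamma(s)\in E$ for all $s\in(t_0,t_1)$ and $\dot\gamma(s)\in J N_K(E)$ for almost every $s\in(t_0,t_1)$. An isotropic gliding set of $\gamma$ is a measurable set $A\subset(0,T)$ of positive measure such that for every $t\in A$ the vector $-J\dot\gamma(t)$ lies in the relative interior of an isotropic extreme face of $N_K(\gamma(t))$ of dimension greater than one, and $\gamma$ does not move along any coisotropic face of $\partial K$ at time $t$. Theorem (Classification of systoles dynamics). Let $\gamma$ be an action-minimizing closed characteristic on $\partial K$. Then for almost every $t\in[0,T]$ at least one of the following holds: (i) $-J\dot\gamma(t)$ lies on an extreme ray of the normal cone $N_K(\gamma(t))$; (ii) $\gamma$ moves along some coisotropic face of $\partial K$ at time $t$; (iii) $\gamma$ exhibits isotropic gliding at time $t$, i.e. $t$ belongs to an isotropic gliding set of $\gamma$. -/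

import Mathlib

open MeasureTheory Set

/-- The phase space `ℝ²ⁿ` with its Euclidean structure; the coordinates `Sum.inl i` are the
positions `q i` and the coordinates `Sum.inr i` are the momenta `p i`. -/
abbrev PhaseSpace (n : ℕ) : Type := EuclideanSpace ℝ (Fin n ⊕ Fin n)

namespace PhaseSpace

/-- The complex structure `J (q, p) = (p, -q)`, so that `x' = J ∇H(x)` is Hamilton's equation
`q' = ∂H/∂p`, `p' = -∂H/∂q`. -/
def J {n : ℕ} : PhaseSpace n →ₗ[ℝ] PhaseSpace n where
  toFun x := WithLp.toLp 2 (Sum.elim (fun i => x (Sum.inr i)) (fun i => -x (Sum.inl i)))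
  map_add' x y := by
    ext k
    rcases k with i | i
    · simp
    · simp [add_comm]
  map_smul' c x := by
    ext k
    rcases k with i | i <;> simp

/-- The standard symplectic form `ω = ∑ dpᵢ ∧ dqᵢ`. -/
def omega {n : ℕ} (u v : PhaseSpace n) : ℝ :=
  ∑ i : Fin n, (u (Sum.inr i) * v (Sum.inl i) - u (Sum.inl i) * v (Sum.inr i))

/-- `W` is isotropic: `ω` vanishes on `W`. -/
def IsIsotropic {n : ℕ} (W : Submodule ℝ (PhaseSpace n)) : Prop :=
  ∀ u ∈ W, ∀ v ∈ W, omega u v = 0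

/-- `W` is coisotropic: it contains its `ω`-orthogonal complement. -/
def IsCoisotropic {n : ℕ} (W : Submodule ℝ (PhaseSpace n)) : Prop :=
  ∀ u, (∀ w ∈ W, omega u w = 0) → u ∈ W

/-- The normal cone `N_K(x)` of `K` at `x`. -/
def normalCone {n : ℕ} (K : Set (PhaseSpace n)) (x : PhaseSpace n) : Set (PhaseSpace n) :=
  {v | ∀ y ∈ K, 0 ≤ inner ℝ v (x - y)}

/-- The normal cone `N_K(E) = ⋂ x ∈ E, N_K(x)` of `K` along a set `E`. -/
def normalConeAlong {n : ℕ} (K E : Set (PhaseSpace n)) : Set (PhaseSpace n) :=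
  ⋂ x ∈ E, normalCone K x

/-- The action `½ ∫₀ᵀ ∑ (pᵢ qᵢ' - qᵢ pᵢ') dt` of a curve on `[0, T]`. -/
noncomputable def action {n : ℕ} (T : ℝ) (γ : ℝ → PhaseSpace n) : ℝ :=
  (1 / 2) * ∫ t in (0 : ℝ)..T, omega (γ t) (deriv γ t)

/-- A (generalized, non-constant) closed characteristic on `∂K`: a closed curve
`γ ∈ W^{1,2}([0, T], ∂K)` with `-J γ'(t) ∈ N_K(γ(t))` for almost every `t`.
Only the values of `γ` on `[0, T]` matter. -/
structure IsClosedCharacteristic {n : ℕ} (K : Set (PhaseSpace n)) (T : ℝ)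
    (γ : ℝ → PhaseSpace n) : Prop where
  period_pos : 0 < T
  absolutelyContinuous : AbsolutelyContinuousOnInterval γ 0 T
  deriv_memLp : MemLp (deriv γ) 2 (volume.restrict (Icc 0 T))
  closed : γ 0 = γ T
  mem_boundary : ∀ t ∈ Icc 0 T, γ t ∈ frontier K
  velocity : ∀ᵐ t ∂volume.restrict (Icc 0 T), -J (deriv γ t) ∈ normalCone K (γ t)
  nonconstant : ∃ t ∈ Icc 0 T, γ t ≠ γ 0

/-- A closed characteristic whose action is minimal among all closed characteristics on `∂K`. -/
def IsActionMinimizing {n : ℕ} (K : Set (PhaseSpace n)) (T : ℝ) (γ : ℝ → PhaseSpace n) : Prop :=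
  IsClosedCharacteristic K T γ ∧
    ∀ (T' : ℝ) (γ' : ℝ → PhaseSpace n), IsClosedCharacteristic K T' γ' → action T γ ≤ action T' γ'

/-- `F` is an extreme face of the convex cone `N`: the intersection of `N` with a linear subspace
that is an extreme subset of `N`. Its dimension is the dimension of its linear span. -/
def IsExtremeFace {n : ℕ} (N F : Set (PhaseSpace n)) : Prop :=
  (∃ L : Submodule ℝ (PhaseSpace n), F = (L : Set (PhaseSpace n)) ∩ N) ∧ IsExtreme ℝ N F

/-- An extreme ray is a one-dimensional extreme face. -/
def IsExtremeRay {n : ℕ} (N R : Set (PhaseSpace n)) : Prop :=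
  IsExtremeFace N R ∧ Module.finrank ℝ (Submodule.span ℝ R) = 1

/-- A coisotropic face of `∂K`: an extreme convex subset `E` of `∂K` such that
`TE = span (E - E)` is coisotropic. -/
def IsCoisotropicFace {n : ℕ} (K E : Set (PhaseSpace n)) : Prop :=
  Convex ℝ E ∧ IsExtreme ℝ (frontier K) E ∧ IsCoisotropic (vectorSpan ℝ E)

/-- `γ` moves along `E` at time `t`: on an open interval around `t`, the curve stays in `E` and
`γ'(s) ∈ J N_K(E)` for almost every `s`. -/
def MovesAlong {n : ℕ} (K : Set (PhaseSpace n)) (T : ℝ) (γ : ℝ → PhaseSpace n)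
    (E : Set (PhaseSpace n)) (t : ℝ) : Prop :=
  ∃ t₀ t₁ : ℝ, t ∈ Ioo t₀ t₁ ∧ Ioo t₀ t₁ ⊆ Icc 0 T ∧ (∀ s ∈ Ioo t₀ t₁, γ s ∈ E) ∧
    ∀ᵐ s ∂volume.restrict (Ioo t₀ t₁), deriv γ s ∈ J '' normalConeAlong K E

/-- An isotropic gliding set of `γ`: a (Lebesgue measurable) set of times of positive measure
such that, at each of its times, `-J γ'(t)` lies in the relative interior of an isotropic extreme
face of `N_K(γ(t))` of dimension greater than one, and `γ` moves along no coisotropic face.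
(On the circle `ℝ / Tℤ` the time `0 = T` is disregarded; it has measure zero.) -/
structure IsIsotropicGlidingSet {n : ℕ} (K : Set (PhaseSpace n)) (T : ℝ) (γ : ℝ → PhaseSpace n)
    (A : Set ℝ) : Prop where
  subset : A ⊆ Ioo 0 T
  measurable : NullMeasurableSet A volume
  pos : 0 < volume A
  isotropic : ∀ t ∈ A, ∃ F, IsExtremeFace (normalCone K (γ t)) F ∧
    IsIsotropic (Submodule.span ℝ F) ∧ 1 < Module.finrank ℝ (Submodule.span ℝ F) ∧
    -J (deriv γ t) ∈ intrinsicInterior ℝ F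
  not_movesAlong : ∀ t ∈ A, ∀ E, IsCoisotropicFace K E → ¬ MovesAlong K T γ E t

end PhaseSpace

/-!
Translate `K` so that `0` is an interior point and put `v = -J γ'`. By Clarke duality, an
action-minimizing `γ` maximizes the enclosed area among the loops with velocity `J u` whose length,
measured by the support function of `K` at `u`, is that of `γ`. At a vector `u` normal to `K` at
`γ t` the support function is `⟪γ t, u⟫`. So if `v + δ` stays in the normal cones, `∫ δ = 0` and
`∫ ⟪γ, δ⟫ = 0`, then passing from `v` to `v + δ` keeps the length, the first variation of the area
vanishes, and the second one, the area of `δ`, cannot be positive.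

Let `p` and `q` be measurable with values in the directions of the minimal face of `N_K(γ t)`
through `v t`. On a short interval `[τ, τ + h]`, the path that follows an even profile in the
direction `p` and an odd one in the direction `q` has area about `-h² ω(p τ, q τ) / 30`. If
`ω(p τ, q τ) < 0` at more than `2 n + 1` Lebesgue points `τ`, some linear combination of these paths
satisfies the `2 n + 1` constraints on `δ` and has positive area. Hence `0 ≤ ω(p, q)` almost
everywhere, and exchanging `p` and `q` gives equality. Applied to a dense sequence of measurable
selections, this shows that the minimal face through `v t` is isotropic for almost every `t`.

If that face is one-dimensional, it is an extreme ray. Otherwise `v t` is a relative interior point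
of an isotropic face of higher dimension, and the times at which `γ` moves along no coisotropic face
form an isotropic gliding set, unless they are negligible.
-/

namespace PhaseSpace

open Filter Topology

variable {n : ℕ}
variable {E : Type*} [NormedAddCommGroup E] [InnerProductSpace ℝ E]

/-! ### The complex structure -/

theorem inner_eq_sum (x y : PhaseSpace n) :
    inner ℝ x y = ∑ i : Fin n, (x (Sum.inl i) * y (Sum.inl i) + x (Sum.inr i) * y (Sum.inr i)) := by
  simp [PiLp.inner_apply, Fintype.sum_sum_type, Finset.sum_add_distrib, mul_comm]

theorem J_inl (x : PhaseSpace n) (i : Fin n) : J x (Sum.inl i) = x (Sum.inr i) := rfl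

theorem J_inr (x : PhaseSpace n) (i : Fin n) : J x (Sum.inr i) = -x (Sum.inl i) := rfl

theorem J_J (x : PhaseSpace n) : J (J x) = -x := by
  ext (i | i) <;> simp [J_inl, J_inr]

theorem inner_J_J (x y : PhaseSpace n) : inner ℝ (J x) (J y) = inner ℝ x y := by
  simp only [inner_eq_sum, J_inl, J_inr]
  exact Finset.sum_congr rfl fun i _ => by ring

theorem inner_J_left (x y : PhaseSpace n) : inner ℝ (J x) y = -inner ℝ x (J y) := by
  rw [← inner_J_J x (J y), J_J, inner_neg_right, neg_neg]

theorem inner_J_comm (x y : PhaseSpace n) : inner ℝ (J x) y = -inner ℝ (J y) x := by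
  rw [inner_J_left, real_inner_comm]

theorem omega_eq_inner (u v : PhaseSpace n) : omega u v = inner ℝ (J u) v := by
  simp only [omega, inner_eq_sum, J_inl, J_inr]
  exact Finset.sum_congr rfl fun i _ => by ring

theorem norm_J (x : PhaseSpace n) : ‖J x‖ = ‖x‖ := by
  rw [norm_eq_sqrt_real_inner, inner_J_J, ← norm_eq_sqrt_real_inner]

/-- The complex structure `J` as a linear isometry. -/
def JIsometry : PhaseSpace n →ₗᵢ[ℝ] PhaseSpace n := ⟨J, norm_J⟩

theorem continuous_J : Continuous (J : PhaseSpace n → PhaseSpace n) :=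
  (JIsometry (n := n)).continuous

theorem lipschitzWith_J : LipschitzWith 1 (J : PhaseSpace n → PhaseSpace n) :=
  (JIsometry (n := n)).lipschitz

theorem hasDerivAt_J_comp {f : ℝ → PhaseSpace n} {f' : PhaseSpace n} {t : ℝ}
    (hf : HasDerivAt f f' t) : HasDerivAt (fun s => J (f s)) (J f') t :=
  (JIsometry (n := n)).toContinuousLinearMap.hasFDerivAt.comp_hasDerivAt t hf

/-! ### Absolutely continuous curves -/

section AbsolutelyContinuous

variable {X Y : Type*} [PseudoMetricSpace X] [PseudoMetricSpace Y] {a b c : ℝ}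

theorem absolutelyContinuousOnInterval_of_dist_le {f : ℝ → X} {g : ℝ → Y} {C : ℝ}
    (hg : AbsolutelyContinuousOnInterval g a b)
    (h : ∀ s ∈ uIcc a b, ∀ t ∈ uIcc a b, dist (f s) (f t) ≤ C * dist (g s) (g t)) :
    AbsolutelyContinuousOnInterval f a b := by
  unfold AbsolutelyContinuousOnInterval at hg ⊢
  refine squeeze_zero' (Eventually.of_forall fun _ => Finset.sum_nonneg fun _ _ => dist_nonneg) ?_
    (by simpa using hg.const_mul C)
  rw [eventually_inf_principal]
  filter_upwards with (m, I) hI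
  rw [Finset.mul_sum]
  exact Finset.sum_le_sum fun i hi => h _ (hI.1 i hi).1 _ (hI.1 i hi).2

theorem absolutelyContinuousOnInterval_comp_of_lipschitz {f : ℝ → X} {g : X → Y} {C : NNReal}
    (hg : LipschitzWith C g) (hf : AbsolutelyContinuousOnInterval f a b) :
    AbsolutelyContinuousOnInterval (fun t => g (f t)) a b :=
  absolutelyContinuousOnInterval_of_dist_le hf fun _ _ _ _ => hg.dist_le_mul _ _

theorem absolutelyContinuousOnInterval_inner {f g : ℝ → E}
    (hf : AbsolutelyContinuousOnInterval f a b) (hg : AbsolutelyContinuousOnInterval g a b) :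
    AbsolutelyContinuousOnInterval (fun t => inner ℝ (f t) (g t)) a b := by
  obtain ⟨C, hC⟩ := hf.exists_bound
  obtain ⟨D, hD⟩ := hg.exists_bound
  unfold AbsolutelyContinuousOnInterval at hf hg
  refine squeeze_zero' (Eventually.of_forall fun _ => Finset.sum_nonneg fun _ _ => dist_nonneg) ?_
    (by simpa using (hg.const_mul C).add (hf.const_mul D))
  rw [eventually_inf_principal]
  filter_upwards with (m, I) hI
  simp only [Finset.mul_sum, ← Finset.sum_add_distrib]
  refine Finset.sum_le_sum fun i hi => ?_
  obtain ⟨hx, hy⟩ := hI.1 i hi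
  generalize (I i).1 = x, (I i).2 = y at hx hy
  have hsplit : inner ℝ (f x) (g x) - inner ℝ (f y) (g y)
      = inner ℝ (f x) (g x - g y) + inner ℝ (f x - f y) (g y) := by
    rw [inner_sub_right, inner_sub_left]; ring
  rw [Real.dist_eq, hsplit, dist_eq_norm, dist_eq_norm]
  refine (abs_add_le _ _).trans (add_le_add ?_ ?_)
  · exact (abs_real_inner_le_norm _ _).trans (by gcongr; exact hC x hx)
  · exact (abs_real_inner_le_norm _ _).trans (by rw [mul_comm]; gcongr; exact hD y hy)

variable {F : Type*} [NormedAddCommGroup F] [NormedSpace ℝ F]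

theorem absolutelyContinuousOnInterval_integral {u : ℝ → F} (hu : IntervalIntegrable u volume a b)
    (hc : c ∈ uIcc a b) : AbsolutelyContinuousOnInterval (fun t => ∫ s in c..t, u s) a b := by
  refine absolutelyContinuousOnInterval_of_dist_le (C := 1)
    (hu.norm.absolutelyContinuousOnInterval_intervalIntegral hc) fun s hs t ht => ?_
  have hsub : ∀ x ∈ uIcc a b, IntervalIntegrable u volume c x := fun x hx =>
    hu.mono_set (uIcc_subset_uIcc hc hx)
  rw [one_mul, dist_eq_norm, Real.dist_eq,
    intervalIntegral.integral_interval_sub_left (hsub s hs) (hsub t ht),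
    intervalIntegral.integral_interval_sub_left (hsub s hs).norm (hsub t ht).norm]
  exact intervalIntegral.norm_integral_le_abs_integral_norm

theorem eq_add_integral_of_ae_hasDerivAt [CompleteSpace F] {f u : ℝ → F}
    (hf : AbsolutelyContinuousOnInterval f a b) (hu : IntervalIntegrable u volume a b)
    (hd : ∀ᵐ t, t ∈ uIcc a b → HasDerivAt f (u t) t) {t : ℝ} (ht : t ∈ uIcc a b) :
    f t = f a + ∫ s in a..t, u s := by
  have hzero : ∀ᵐ x, x ∈ uIcc a b → HasDerivAt (fun t => f t - ∫ s in a..t, u s) 0 x := by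
    filter_upwards [hd, hu.ae_hasDerivAt_integral] with x h1 h2 hx
    simpa using (h1 hx).fun_sub (h2 hx a left_mem_uIcc)
  obtain ⟨C, hC⟩ := (hf.fun_sub
    (absolutelyContinuousOnInterval_integral hu left_mem_uIcc)).const_of_ae_hasDerivAt_zero hzero
  have ha := hC a left_mem_uIcc
  rw [intervalIntegral.integral_same, sub_zero] at ha
  rw [ha, ← hC t ht, sub_add_cancel]

end AbsolutelyContinuous

/-! ### Primitives and the area form -/

section primitive

variable {F : Type*} [NormedAddCommGroup F] [NormedSpace ℝ F] {u v : ℝ → F}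

/-- The primitive of `u` vanishing at `0`. Curves starting at `0` are encoded by their velocity
`u`, and `u` encodes a loop on `[0, T]` when `primitive u T = 0`. -/
noncomputable def primitive (u : ℝ → F) (t : ℝ) : F := ∫ s in (0 : ℝ)..t, u s

theorem primitive_zero (u : ℝ → F) : primitive u 0 = 0 := by simp [primitive]

theorem primitive_add (hu : Integrable u) (hv : Integrable v) (t : ℝ) :
    primitive (fun s => u s + v s) t = primitive u t + primitive v t :=
  intervalIntegral.integral_add hu.intervalIntegrable hv.intervalIntegrable

theorem primitive_smul (c : ℝ) (u : ℝ → F) (t : ℝ) :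
    primitive (fun s => c • u s) t = c • primitive u t :=
  intervalIntegral.integral_smul _ _

theorem primitive_sub_primitive (hu : Integrable u) (s t : ℝ) :
    primitive u t - primitive u s = ∫ x in s..t, u x :=
  intervalIntegral.integral_interval_sub_left hu.intervalIntegrable hu.intervalIntegrable

theorem continuous_primitive (hu : Integrable u) : Continuous (primitive u) :=
  intervalIntegral.continuous_primitive (fun _ _ => hu.intervalIntegrable) 0

theorem absolutelyContinuousOnInterval_primitive (hu : Integrable u) {a b : ℝ}
    (h0 : 0 ∈ uIcc a b) : AbsolutelyContinuousOnInterval (primitive u) a b :=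
  absolutelyContinuousOnInterval_integral hu.intervalIntegrable h0

theorem ae_hasDerivAt_primitive [CompleteSpace F] (hu : Integrable u) :
    ∀ᵐ t, HasDerivAt (primitive u) (u t) t := by
  filter_upwards [LocallyIntegrable.ae_hasDerivAt_integral hu.locallyIntegrable] with t ht
  exact ht 0

end primitive

theorem integrableOn_inner_of_norm_le {f g : ℝ → E} {s : Set ℝ} (hs : MeasurableSet s) {C : ℝ}
    (hf : AEStronglyMeasurable f (volume.restrict s)) (hC : ∀ t ∈ s, ‖f t‖ ≤ C)
    (hg : IntegrableOn g s) : IntegrableOn (fun t => inner ℝ (f t) (g t)) s := by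
  refine (hg.norm.const_mul C).mono' (hf.inner hg.1) ?_
  refine (ae_restrict_iff' hs).2 (ae_of_all _ fun t ht => ?_)
  exact (norm_inner_le_norm _ _).trans (by gcongr; exact hC t ht)

theorem intervalIntegrable_inner {f g : ℝ → E} (hf : Continuous f) (hg : Integrable g) (a b : ℝ) :
    IntervalIntegrable (fun t => inner ℝ (f t) (g t)) volume a b := by
  obtain ⟨C, hC⟩ := isCompact_uIcc.exists_bound_of_continuousOn (s := uIcc a b) hf.continuousOn
  rw [intervalIntegrable_iff]
  exact integrableOn_inner_of_norm_le measurableSet_uIoc hf.aestronglyMeasurable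
    (fun t ht => hC t (uIoc_subset_uIcc ht)) hg.integrableOn

section areaForm

variable {T : ℝ} {u v w : ℝ → PhaseSpace n}

/-- The bilinear form polarising twice the action of the loop with velocity `J u`. -/
noncomputable def areaForm (T : ℝ) (u v : ℝ → PhaseSpace n) : ℝ :=
  ∫ t in (0 : ℝ)..T, inner ℝ (J (primitive u t)) (v t)

theorem intervalIntegrable_areaForm (hu : Integrable u) (hv : Integrable v) (a b : ℝ) :
    IntervalIntegrable (fun t => inner ℝ (J (primitive u t)) (v t)) volume a b :=
  intervalIntegrable_inner (continuous_J.comp (continuous_primitive hu)) hv a b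

theorem areaForm_add_right (hu : Integrable u) (hv : Integrable v) (hw : Integrable w) :
    areaForm T u (fun t => v t + w t) = areaForm T u v + areaForm T u w := by
  simp only [areaForm, inner_add_right]
  exact intervalIntegral.integral_add (intervalIntegrable_areaForm hu hv _ _)
    (intervalIntegrable_areaForm hu hw _ _)

theorem areaForm_add_left (hu : Integrable u) (hv : Integrable v) (hw : Integrable w) :
    areaForm T (fun t => u t + v t) w = areaForm T u w + areaForm T v w := by
  simp only [areaForm, primitive_add hu hv, map_add, inner_add_left]
  exact intervalIntegral.integral_add (intervalIntegrable_areaForm hu hw _ _)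
    (intervalIntegrable_areaForm hv hw _ _)

theorem areaForm_smul_right (c : ℝ) : areaForm T u (fun t => c • v t) = c * areaForm T u v := by
  simp only [areaForm, inner_smul_right]
  exact intervalIntegral.integral_const_mul _ _

theorem areaForm_smul_left (c : ℝ) : areaForm T (fun t => c • u t) v = c * areaForm T u v := by
  simp only [areaForm, primitive_smul, map_smul, real_inner_smul_left]
  exact intervalIntegral.integral_const_mul _ _

theorem areaForm_sub_areaForm (hu : Integrable u) (hv : Integrable v) :
    areaForm T u v - areaForm T v u = inner ℝ (J (primitive u T)) (primitive v T) := by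
  have hac : AbsolutelyContinuousOnInterval
      (fun t => inner ℝ (J (primitive u t)) (primitive v t)) 0 T :=
    absolutelyContinuousOnInterval_inner
      (absolutelyContinuousOnInterval_comp_of_lipschitz lipschitzWith_J
        (absolutelyContinuousOnInterval_primitive hu left_mem_uIcc))
      (absolutelyContinuousOnInterval_primitive hv left_mem_uIcc)
  have hftc := hac.integral_deriv_eq_sub
  simp only [primitive_zero, map_zero, inner_zero_left, sub_zero] at hftc
  rw [← hftc, areaForm, areaForm, ← intervalIntegral.integral_sub
    (intervalIntegrable_areaForm hu hv _ _) (intervalIntegrable_areaForm hv hu _ _)]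
  refine intervalIntegral.integral_congr_ae ?_
  filter_upwards [ae_hasDerivAt_primitive hu, ae_hasDerivAt_primitive hv] with t hut hvt _
  rw [((hasDerivAt_J_comp hut).inner ℝ hvt).deriv, inner_J_comm (u t) (primitive v t)]
  ring

theorem areaForm_comm (hu : Integrable u) (hv : Integrable v) (h0 : primitive u T = 0) :
    areaForm T u v = areaForm T v u := by
  have := areaForm_sub_areaForm (T := T) hu hv
  rw [h0, map_zero, inner_zero_left] at this
  linarith

end areaForm

/-! ### Velocities dominated by a density -/

/-- The velocities `u` for which the support function of `K` at `u t` is at most `ρ t`: on the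
curve with velocity `J u`, the length measured by that support function has density at
most `ρ`. -/
structure Admissible (K : Set E) (ρ : ℝ → ℝ) (u : ℝ → E) : Prop where
  integrable : Integrable u
  inner_le : ∀ᵐ t, ∀ x ∈ K, inner ℝ (u t) x ≤ ρ t

/-- The admissible velocities of the loops on `[0, T]`. -/
def admissibleLoops (K : Set E) (ρ : ℝ → ℝ) (T : ℝ) : Set (ℝ → E) :=
  {u | Admissible K ρ u ∧ primitive u T = 0}

/-- The curves on `[0, T]` from `0` to `0` whose increments are dominated by those of `R`, in the
sense of the support function of `K`. -/
def dominatedLoops (K : Set E) (R : ℝ → ℝ) (T : ℝ) : Set (Icc 0 T → E) :=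
  {U | (∀ t : Icc 0 T, (t : ℝ) = 0 ∨ (t : ℝ) = T → U t = 0) ∧
    ∀ s t : Icc 0 T, s ≤ t → ∀ x ∈ K, inner ℝ (U t - U s) x ≤ R t - R s}

theorem mul_norm_le_of_forall_inner_le {K : Set E} {r c : ℝ} {u : E}
    (hr : 0 ≤ r) (hK : Metric.closedBall 0 r ⊆ K) (h : ∀ x ∈ K, inner ℝ u x ≤ c) :
    r * ‖u‖ ≤ c := by
  have hinner := h ((r * ‖u‖⁻¹) • u) (hK (by
    rw [mem_closedBall_zero_iff, norm_smul, Real.norm_of_nonneg (by positivity), mul_assoc]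
    exact mul_le_of_le_one_right hr inv_mul_le_one))
  rw [inner_smul_right, real_inner_self_eq_norm_sq] at hinner
  rcases eq_or_ne ‖u‖ 0 with hu | hu
  · simpa [hu] using hinner
  · calc r * ‖u‖ = r * ‖u‖⁻¹ * ‖u‖ ^ 2 := by field_simp
      _ ≤ c := hinner

section Admissible

variable {K : Set E} {ρ : ℝ → ℝ} {u v : ℝ → E} {r T : ℝ}

theorem Admissible.ae_norm_le (hu : Admissible K ρ u) (hr : 0 < r)
    (hK : Metric.closedBall 0 r ⊆ K) : ∀ᵐ t, ‖u t‖ ≤ r⁻¹ * ρ t := by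
  filter_upwards [hu.inner_le] with t ht
  rw [le_inv_mul_iff₀ hr]
  exact mul_norm_le_of_forall_inner_le hr.le hK ht

theorem Admissible.convex_comb (hu : Admissible K ρ u) (hv : Admissible K ρ v) {a b : ℝ}
    (ha : 0 ≤ a) (hb : 0 ≤ b) (hab : a + b = 1) :
    Admissible K ρ (fun t => a • u t + b • v t) := by
  refine ⟨(hu.integrable.smul a).add (hv.integrable.smul b), ?_⟩
  filter_upwards [hu.inner_le, hv.inner_le] with t hut hvt x hx
  rw [inner_add_left, real_inner_smul_left, real_inner_smul_left]
  calc a * inner ℝ (u t) x + b * inner ℝ (v t) x ≤ a * ρ t + b * ρ t := by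
        gcongr
        · exact hut x hx
        · exact hvt x hx
    _ = ρ t := by rw [← add_mul, hab, one_mul]

theorem admissibleLoops.convex_comb (hu : u ∈ admissibleLoops K ρ T)
    (hv : v ∈ admissibleLoops K ρ T) {a b : ℝ} (ha : 0 ≤ a) (hb : 0 ≤ b) (hab : a + b = 1) :
    (fun t => a • u t + b • v t) ∈ admissibleLoops K ρ T := by
  refine ⟨hu.1.convex_comb hv.1 ha hb hab, ?_⟩
  rw [primitive_add (hu.1.integrable.fun_smul a) (hv.1.integrable.fun_smul b), primitive_smul,
    primitive_smul, hu.2, hv.2, smul_zero, smul_zero, add_zero]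

theorem Admissible.inner_primitive_sub_le [CompleteSpace E] (hu : Admissible K ρ u)
    (hρ : Integrable ρ) {s t : ℝ} (hst : s ≤ t) {x : E} (hx : x ∈ K) :
    inner ℝ (primitive u t - primitive u s) x ≤ primitive ρ t - primitive ρ s := by
  rw [primitive_sub_primitive hu.integrable, primitive_sub_primitive hρ, real_inner_comm,
    intervalIntegral.integral_of_le hst, ← integral_inner hu.integrable.integrableOn,
    ← intervalIntegral.integral_of_le hst]
  refine intervalIntegral.integral_mono_ae hst
    (intervalIntegrable_inner continuous_const hu.integrable _ _) hρ.intervalIntegrable ?_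
  filter_upwards [hu.inner_le] with t ht
  rw [real_inner_comm]
  exact ht x hx

theorem primitive_mem_dominatedLoops [CompleteSpace E] (hρ : Integrable ρ)
    (hu : u ∈ admissibleLoops K ρ T) :
    (fun t : Icc 0 T => primitive u t) ∈ dominatedLoops K (primitive ρ) T := by
  refine ⟨?_, fun s t hst x hx => hu.1.inner_primitive_sub_le hρ hst hx⟩
  rintro t (ht | ht)
  · simp only [ht, primitive_zero]
  · simp only [ht, hu.2]

theorem isClosed_dominatedLoops (K : Set E) (R : ℝ → ℝ) (T : ℝ) :
    IsClosed (dominatedLoops K R T) := by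
  simp only [dominatedLoops, ofPred_and, ofPred_forall]
  refine (isClosed_iInter fun t => isClosed_iInter fun _ =>
    isClosed_eq (continuous_apply t) continuous_const).inter ?_
  refine isClosed_iInter fun s => isClosed_iInter fun t => isClosed_iInter fun _ =>
    isClosed_iInter fun x => isClosed_iInter fun _ => isClosed_le ?_ continuous_const
  exact ((continuous_apply t).sub (continuous_apply s)).inner continuous_const

section dominatedLoops

variable {R : ℝ → ℝ} {U : Icc 0 T → E}

theorem norm_sub_le_of_mem_dominatedLoops (hU : U ∈ dominatedLoops K R T) (hr : 0 < r)
    (hK : Metric.closedBall 0 r ⊆ K) (s t : Icc 0 T) : ‖U t - U s‖ ≤ r⁻¹ * |R t - R s| := by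
  wlog hst : s ≤ t generalizing s t
  · rw [norm_sub_rev, abs_sub_comm]
    exact this t s (le_of_not_ge hst)
  rw [le_inv_mul_iff₀ hr]
  exact (mul_norm_le_of_forall_inner_le hr.le hK (hU.2 s t hst)).trans (le_abs_self _)

theorem continuous_of_mem_dominatedLoops (hU : U ∈ dominatedLoops K R T) (hR : Continuous R)
    (hr : 0 < r) (hK : Metric.closedBall 0 r ⊆ K) : Continuous U := by
  refine continuous_iff_continuousAt.2 fun s => tendsto_iff_norm_sub_tendsto_zero.2 ?_
  refine squeeze_zero (fun _ => norm_nonneg _)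
    (fun t => norm_sub_le_of_mem_dominatedLoops hU hr hK s t) ?_
  have hcont : Continuous fun t : Icc 0 T => r⁻¹ * |R t - R s| := by fun_prop
  simpa using hcont.tendsto s

theorem isCompact_dominatedLoops [ProperSpace E] (hT : 0 ≤ T) (hR : Continuous R) (hr : 0 < r)
    (hK : Metric.closedBall 0 r ⊆ K) :
    IsCompact {U : C(Icc 0 T, E) | ⇑U ∈ dominatedLoops K R T} := by
  refine ArzelaAscoli.isCompact_of_equicontinuous _ ?_ fun s => ?_
  · have himage : ContinuousMap.toFun '' {U : C(Icc 0 T, E) | ⇑U ∈ dominatedLoops K R T}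
        = dominatedLoops K R T := by
      refine subset_antisymm (image_subset_iff.2 fun U hU => hU) fun U hU => ?_
      exact ⟨⟨U, continuous_of_mem_dominatedLoops hU hR hr hK⟩, hU, rfl⟩
    rw [himage]
    refine IsCompact.of_isClosed_subset (isCompact_univ_pi fun t : Icc 0 T =>
      isCompact_closedBall (0 : E) (r⁻¹ * |R t - R 0|))
      (isClosed_dominatedLoops K R T) fun U hU t _ => ?_
    have hbound := norm_sub_le_of_mem_dominatedLoops hU hr hK ⟨0, le_rfl, hT⟩ t
    rw [hU.1 ⟨0, le_rfl, hT⟩ (Or.inl rfl), sub_zero] at hbound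
    simpa using hbound
  · rw [Metric.equicontinuousAt_iff_right]
    intro ε hε
    have hcont : Continuous fun t : Icc 0 T => r⁻¹ * |R t - R s| := by fun_prop
    filter_upwards [(hcont.tendsto s).eventually_lt_const (u := ε) (by simpa using hε)] with t ht U
    rw [dist_comm, dist_eq_norm]
    exact (norm_sub_le_of_mem_dominatedLoops U.2 hr hK s t).trans_lt ht

end dominatedLoops

theorem inner_le_of_hasDerivAt_of_forall_inner_sub_le {V : ℝ → E} {R : ℝ → ℝ} {V' x : E}
    {R' a b t : ℝ} (hV : HasDerivAt V V' t) (hR : HasDerivAt R R' t) (ht : t ∈ Ioo a b)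
    (h : ∀ p ∈ Icc a b, ∀ q ∈ Icc a b, p ≤ q → inner ℝ (V q - V p) x ≤ R q - R p) :
    inner ℝ V' x ≤ R' := by
  have hmono : MonotoneOn (fun s => R s - inner ℝ (V s) x) (Icc a b) := fun p hp q hq hpq => by
    have := h p hp q hq hpq
    rw [inner_sub_left] at this
    dsimp only
    linarith
  have hderiv : HasDerivAt (fun s => R s - inner ℝ (V s) x) (R' - inner ℝ V' x) t := by
    simpa using hR.fun_sub (hV.inner ℝ (hasDerivAt_const t x))
  have hnonneg := hmono.derivWithin_nonneg (x := t)
  rw [derivWithin_of_mem_nhds (Icc_mem_nhds ht.1 ht.2), hderiv.deriv] at hnonneg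
  linarith

theorem absolutelyContinuousOnInterval_iccExtend_of_mem_dominatedLoops (hT : 0 ≤ T)
    (hρ : Integrable ρ) (hr : 0 < r) (hK : Metric.closedBall 0 r ⊆ K) {U : Icc 0 T → E}
    (hU : U ∈ dominatedLoops K (primitive ρ) T) :
    AbsolutelyContinuousOnInterval (IccExtend hT U) 0 T := by
  refine absolutelyContinuousOnInterval_of_dist_le (C := r⁻¹)
    (absolutelyContinuousOnInterval_primitive hρ left_mem_uIcc) fun s hs t ht => ?_
  rw [uIcc_of_le hT] at hs ht
  rw [dist_comm, dist_eq_norm, dist_comm, Real.dist_eq, IccExtend_of_mem hT U hs,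
    IccExtend_of_mem hT U ht]
  exact norm_sub_le_of_mem_dominatedLoops hU hr hK ⟨s, hs⟩ ⟨t, ht⟩

theorem exists_mem_admissibleLoops_primitive_eq [FiniteDimensional ℝ E] (hT : 0 ≤ T)
    (hρ : Integrable ρ) (hρ0 : ∀ t, 0 ≤ ρ t) (hr : 0 < r) (hK : Metric.closedBall 0 r ⊆ K)
    {U : Icc 0 T → E} (hU : U ∈ dominatedLoops K (primitive ρ) T) :
    ∃ u ∈ admissibleLoops K ρ T, ∀ t : Icc 0 T, primitive u t = U t := by
  borelize E
  set V := IccExtend hT U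
  have hVU : ∀ t (ht : t ∈ Icc 0 T), V t = U ⟨t, ht⟩ := fun t ht => IccExtend_of_mem hT U ht
  have hac : AbsolutelyContinuousOnInterval V 0 T :=
    absolutelyContinuousOnInterval_iccExtend_of_mem_dominatedLoops hT hρ hr hK hU
  have hdiff := hac.boundedVariationOn.ae_differentiableAt_of_mem_uIcc
  rw [uIcc_of_le hT] at hdiff
  set u := (Ioo 0 T).indicator (deriv V) with hu
  have hinner : ∀ᵐ t, ∀ x ∈ K, inner ℝ (u t) x ≤ ρ t := by
    filter_upwards [hdiff, ae_hasDerivAt_primitive hρ] with t hVt hρt x hx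
    by_cases ht : t ∈ Ioo 0 T
    · rw [hu, indicator_of_mem ht]
      refine inner_le_of_hasDerivAt_of_forall_inner_sub_le
        (hVt (Ioo_subset_Icc_self ht)).hasDerivAt hρt ht fun p hp q hq hpq => ?_
      rw [hVU p hp, hVU q hq]
      exact hU.2 ⟨p, hp⟩ ⟨q, hq⟩ hpq x hx
    · rw [hu, indicator_of_notMem ht, inner_zero_left]
      exact hρ0 t
  have hint : Integrable u := by
    refine (hρ.const_mul r⁻¹).mono'
      ((measurable_deriv V).aestronglyMeasurable.indicator measurableSet_Ioo) ?_
    filter_upwards [hinner] with t ht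
    rw [le_inv_mul_iff₀ hr]
    exact mul_norm_le_of_forall_inner_le hr.le hK ht
  have hderiv : ∀ᵐ t, t ∈ uIcc 0 T → HasDerivAt V (u t) t := by
    rw [uIcc_of_le hT]
    filter_upwards [hdiff, Ioo_ae_eq_Icc (a := 0) (b := T) (μ := volume).mem_iff] with t hVt hIoo ht
    rw [hu, indicator_of_mem (hIoo.mpr ht)]
    exact (hVt ht).hasDerivAt
  have hprim : ∀ t : Icc 0 T, primitive u t = U t := fun t => by
    have := eq_add_integral_of_ae_hasDerivAt hac hint.intervalIntegrable hderiv (t := t)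
      (by rw [uIcc_of_le hT]; exact t.2)
    rw [hVU t t.2, hVU 0 ⟨le_rfl, hT⟩, hU.1 ⟨0, le_rfl, hT⟩ (Or.inl rfl), zero_add] at this
    exact this.symm
  exact ⟨u, ⟨⟨hint, hinner⟩, (hprim ⟨T, hT, le_rfl⟩).trans (hU.1 _ (Or.inr rfl))⟩, hprim⟩

end Admissible

theorem exists_isMaxOn_admissibleLoops [FiniteDimensional ℝ E] {K : Set E} {ρ : ℝ → ℝ} {r T : ℝ}
    (hT : 0 ≤ T) (hρ : Integrable ρ) (hρ0 : ∀ t, 0 ≤ ρ t) (hr : 0 < r)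
    (hK : Metric.closedBall 0 r ⊆ K) {Φ : (ℝ → E) → ℝ} {C : ℝ}
    (hΦ : ∀ u ∈ admissibleLoops K ρ T, ∀ v ∈ admissibleLoops K ρ T, ∀ ε,
      (∀ t ∈ Icc 0 T, ‖primitive u t - primitive v t‖ ≤ ε) → |Φ u - Φ v| ≤ C * ε) :
    ∃ u ∈ admissibleLoops K ρ T, IsMaxOn Φ (admissibleLoops K ρ T) u := by
  set S := {U : C(Icc 0 T, E) | ⇑U ∈ dominatedLoops K (primitive ρ) T}
  have hS : IsCompact S := isCompact_dominatedLoops hT (continuous_primitive hρ) hr hK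
  have hvelocity : ∀ U ∈ S, ∃ u ∈ admissibleLoops K ρ T, ∀ t : Icc 0 T, primitive u t = U t :=
    fun U hU => exists_mem_admissibleLoops_primitive_eq hT hρ hρ0 hr hK hU
  choose! f hf hfU using hvelocity
  have hcont : ContinuousOn (fun U => Φ (f U)) S := by
    refine LipschitzOnWith.continuousOn (K := C.toNNReal)
      (LipschitzOnWith.of_dist_le_mul fun U hU V hV => ?_)
    refine (hΦ _ (hf U hU) _ (hf V hV) (dist U V) fun t ht => ?_).trans
      (by gcongr; exact C.le_coe_toNNReal)
    rw [hfU U hU ⟨t, ht⟩, hfU V hV ⟨t, ht⟩, ← dist_eq_norm]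
    exact ContinuousMap.dist_apply_le_dist _
  have hzero : (0 : C(Icc 0 T, E)) ∈ S := by
    refine ⟨fun _ _ => rfl, fun s t hst _ _ => ?_⟩
    simp only [ContinuousMap.coe_zero, Pi.zero_apply, sub_zero, inner_zero_left]
    rw [primitive_sub_primitive hρ]
    exact intervalIntegral.integral_nonneg hst fun t _ => hρ0 t
  obtain ⟨U, hU, hmax⟩ := hS.exists_isMaxOn ⟨0, hzero⟩ hcont
  refine ⟨f U, hf U hU, fun v hv => ?_⟩
  let V : C(Icc 0 T, E) :=
    ⟨fun t => primitive v t, (continuous_primitive hv.1.integrable).comp continuous_subtype_val⟩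
  have hV : V ∈ S := primitive_mem_dominatedLoops hρ hv
  have hle := hΦ v hv _ (hf V hV) 0 fun t ht => by rw [hfU V hV ⟨t, ht⟩]; simp [V]
  rw [mul_zero, abs_nonpos_iff, sub_eq_zero] at hle
  exact hle.trans_le (hmax hV)

theorem le_of_forall_quadratic_le {a b c : ℝ}
    (h : ∀ ε ∈ Ioc (0 : ℝ) 1, (1 - ε) ^ 2 * a + 2 * (1 - ε) * ε * b + ε ^ 2 * c ≤ a) : b ≤ a := by
  have hdiv : ∀ᶠ ε in 𝓝[>] (0 : ℝ), (ε - 2) * a + 2 * (1 - ε) * b + ε * c ≤ 0 := by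
    filter_upwards [Ioc_mem_nhdsGT one_pos] with ε hε
    refine nonpos_of_mul_nonpos_right (a := ε) ?_ hε.1
    linarith [h ε hε]
  have hcont : Continuous fun ε : ℝ => (ε - 2) * a + 2 * (1 - ε) * b + ε * c := by fun_prop
  have hlim := le_of_tendsto ((hcont.tendsto 0).mono_left nhdsWithin_le_nhds) hdiv
  linarith

section maximal

variable {K : Set (PhaseSpace n)} {ρ : ℝ → ℝ} {u v : ℝ → PhaseSpace n} {r T : ℝ}

theorem abs_areaForm_sub_le (hT : 0 ≤ T) (hρ : Integrable ρ) (hr : 0 < r)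
    (hK : Metric.closedBall 0 r ⊆ K) (hu : u ∈ admissibleLoops K ρ T) (hv : Admissible K ρ v)
    {ε : ℝ} (hε : ∀ t ∈ Icc 0 T, ‖primitive u t - primitive v t‖ ≤ ε) :
    |areaForm T u u - areaForm T v v| ≤ 2 * r⁻¹ * primitive ρ T * ε := by
  have hui := hu.1.integrable
  have hvi := hv.integrable
  have hneg : Integrable fun t => (-1 : ℝ) • v t := hvi.smul (-1 : ℝ)
  have hdiff : areaForm T u u - areaForm T v v =
      areaForm T (fun t => u t + (-1 : ℝ) • v t) (fun t => u t + v t) := by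
    rw [areaForm_add_left hui hneg (hui.fun_add hvi), areaForm_smul_left,
      areaForm_add_right hui hui hvi, areaForm_add_right hvi hui hvi, areaForm_comm hui hvi hu.2]
    ring
  rw [hdiff, areaForm, ← Real.norm_eq_abs]
  refine (intervalIntegral.norm_integral_le_of_norm_le hT
    (g := fun t => ε * (2 * r⁻¹ * ρ t)) ?_ ?_).trans_eq ?_
  · filter_upwards [hu.1.ae_norm_le hr hK, hv.ae_norm_le hr hK] with t hut hvt ht
    have hprim : ‖J (primitive (fun t => u t + (-1 : ℝ) • v t) t)‖ ≤ ε := by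
      rw [norm_J, primitive_add hui hneg, primitive_smul, neg_one_smul, ← sub_eq_add_neg]
      exact hε t (Ioc_subset_Icc_self ht)
    have hsum : ‖u t + v t‖ ≤ 2 * r⁻¹ * ρ t := (norm_add_le _ _).trans (by linarith)
    exact (norm_inner_le_norm _ _).trans
      (mul_le_mul hprim hsum (norm_nonneg _) ((norm_nonneg _).trans hprim))
  · exact ((hρ.const_mul _).const_mul _).intervalIntegrable
  · rw [intervalIntegral.integral_const_mul, intervalIntegral.integral_const_mul, mul_comm]
    rfl

theorem exists_isMaxOn_areaForm (hT : 0 ≤ T) (hρ : Integrable ρ) (hρ0 : ∀ t, 0 ≤ ρ t)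
    (hK : K ∈ 𝓝 0) :
    ∃ u ∈ admissibleLoops K ρ T, IsMaxOn (fun u => areaForm T u u) (admissibleLoops K ρ T) u := by
  obtain ⟨r, hr, hrK⟩ := Metric.nhds_basis_closedBall.mem_iff.1 hK
  exact exists_isMaxOn_admissibleLoops hT hρ hρ0 hr hrK fun u hu v hv ε hε =>
    abs_areaForm_sub_le hT hρ hr hrK hu hv.1 hε

theorem areaForm_le_of_isMaxOn (hu : u ∈ admissibleLoops K ρ T)
    (hmax : IsMaxOn (fun u => areaForm T u u) (admissibleLoops K ρ T) u)
    (hv : v ∈ admissibleLoops K ρ T) : areaForm T u v ≤ areaForm T u u := by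
  refine le_of_forall_quadratic_le (c := areaForm T v v) fun ε hε => ?_
  have hui := hu.1.integrable
  have hvi := hv.1.integrable
  have hus : Integrable fun t => (1 - ε) • u t := hui.smul (1 - ε)
  have hvs : Integrable fun t => ε • v t := hvi.smul ε
  have hexpand : areaForm T _ _ ≤ areaForm T u u :=
    hmax (admissibleLoops.convex_comb hu hv (sub_nonneg.2 hε.2) hε.1.le (by ring))
  rw [areaForm_add_left hus hvs (hus.fun_add hvs), areaForm_smul_left,
    areaForm_smul_left, areaForm_add_right hui hus hvs, areaForm_add_right hvi hus hvs,
    areaForm_smul_right, areaForm_smul_right, areaForm_smul_right, areaForm_smul_right,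
    ← areaForm_comm hui hvi hu.2] at hexpand
  linarith

end maximal

/-! ### The polar body -/

/-- The polar body of `K`: the unit ball of the support function of `K`. Its own support function
is the gauge of `K`. -/
def polarBody (K : Set E) : Set E := {k | ∀ x ∈ K, inner ℝ k x ≤ 1}

section polar

variable {K : Set E} {ρ : ℝ → ℝ}

theorem zero_mem_polarBody (K : Set E) : 0 ∈ polarBody K := fun x _ => by simp

theorem polarBody_mem_nhds_zero (hK : Bornology.IsBounded K) : polarBody K ∈ 𝓝 0 := by
  obtain ⟨R, hR, hKR⟩ := hK.exists_pos_norm_le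
  refine Metric.mem_nhds_iff.2 ⟨R⁻¹, inv_pos.2 hR, fun k hk x hx => ?_⟩
  rw [mem_ball_zero_iff] at hk
  calc inner ℝ k x ≤ ‖k‖ * ‖x‖ := real_inner_le_norm _ _
    _ ≤ R⁻¹ * R := by gcongr; exact hKR x hx
    _ = 1 := inv_mul_cancel₀ hR.ne'

theorem Admissible.smul_const (hρ : Integrable ρ) (hρ0 : ∀ t, 0 ≤ ρ t) {k : E}
    (hk : k ∈ polarBody K) : Admissible K ρ (fun t => ρ t • k) := by
  refine ⟨hρ.smul_const k, ae_of_all _ fun t x hx => ?_⟩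
  rw [real_inner_smul_left]
  exact mul_le_of_le_one_right (hρ0 t) (hk x hx)

theorem inner_le_mul_gauge (hK : K ∈ 𝓝 0) {u : E} {c : ℝ} (h : ∀ x ∈ K, inner ℝ u x ≤ c) (x : E) :
    inner ℝ u x ≤ c * gauge K x := by
  have hc : 0 ≤ c := by simpa using h 0 (mem_of_mem_nhds hK)
  refine ge_of_tendsto (((continuous_const_mul c).tendsto (gauge K x)).mono_left
    (nhdsWithin_le_nhds (s := Ioi (gauge K x)))) ?_
  filter_upwards [self_mem_nhdsWithin] with b hb
  obtain ⟨a, ha, hab, y, hy, rfl⟩ := exists_lt_of_gauge_lt (absorbent_nhds_zero hK) hb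
  rw [inner_smul_right, mul_comm]
  exact mul_le_mul (h y hy) hab.le ha.le hc

theorem gauge_le_of_forall_mem_polarBody_inner_le [CompleteSpace E] (hconv : Convex ℝ K)
    (hclosed : IsClosed K) (h0 : 0 ∈ K) {x : E} {c : ℝ}
    (h : ∀ k ∈ polarBody K, inner ℝ k x ≤ c) : gauge K x ≤ c := by
  by_contra! hlt
  obtain ⟨b, hcb, hbx⟩ := exists_between hlt
  have hb : 0 < b := (by simpa using h 0 (zero_mem_polarBody K) : 0 ≤ c).trans_lt hcb
  have hnot : b⁻¹ • x ∉ K := fun hmem =>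
    hbx.not_ge (gauge_le_of_mem hb.le ⟨_, hmem, smul_inv_smul₀ hb.ne' x⟩)
  obtain ⟨f, a, hfa, hax⟩ := geometric_hahn_banach_closed_point hconv hclosed hnot
  have ha : 0 < a := by simpa using hfa 0 h0
  set z := (InnerProductSpace.toDual ℝ E).symm f
  have hzf : ∀ y, inner ℝ z y = f y := fun y => InnerProductSpace.toDual_symm_apply
  have hk : a⁻¹ • z ∈ polarBody K := fun y hy => by
    rw [real_inner_smul_left, inv_mul_le_one₀ ha, hzf]
    exact (hfa y hy).le
  have hle := h _ hk
  rw [real_inner_smul_left, hzf, inv_mul_le_iff₀ ha] at hle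
  rw [map_smul, smul_eq_mul, lt_inv_mul_iff₀ hb] at hax
  nlinarith

end polar

/-! ### Lagrange multipliers for the closing condition -/

theorem exists_forall_le_add_of_convex {F : Type*} [NormedAddCommGroup F] [NormedSpace ℝ F]
    {D : Set (F × ℝ)} (hD : Convex ℝ D) {V : Set F} (hV : V ∈ 𝓝 0) {a b : ℝ}
    (hVD : V ×ˢ Iio b ⊆ D) (ha : ∀ s, (0, s) ∈ D → s ≤ a) :
    ∃ φ : F →L[ℝ] ℝ, ∀ x s, (x, s) ∈ D → s ≤ φ x + a := by
  have hint : (0, b - 1) ∈ interior D :=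
    mem_interior_iff_mem_nhds.2 (mem_of_superset
      (prod_mem_nhds hV (Iio_mem_nhds (sub_one_lt b))) hVD)
  have hnot : ((0 : F), a) ∉ interior D := fun hmem => by
    have hcont : Tendsto (Prod.mk (0 : F)) (𝓝[>] a) (𝓝 (0, a)) :=
      tendsto_nhdsWithin_of_tendsto_nhds (Continuous.prodMk_right _).continuousAt
    obtain ⟨s, hs, has⟩ :=
      ((hcont.eventually (mem_interior_iff_mem_nhds.1 hmem)).and self_mem_nhdsWithin).exists
    exact (ha s hs).not_gt has
  obtain ⟨f, hf0, hf⟩ := geometric_hahn_banach_of_nonempty_interior_point hD hnot ⟨_, hint⟩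
  set φ := f.comp (ContinuousLinearMap.inl ℝ F ℝ) with hφ
  set l := f (0, 1) with hl
  have hsplit : ∀ x s, f (x, s) = φ x + s * l := fun x s => by
    rw [hφ, hl, ← smul_eq_mul, ← map_smul, ContinuousLinearMap.comp_apply, ← map_add]
    simp
  have hle : ∀ x s, (x, s) ∈ D → φ x + s * l ≤ a * l := fun x s hs => by
    simpa [hsplit] using hf (x, s) hs
  have hlpos : 0 < l := by
    by_contra! hl0
    have hmax : IsLocalMax φ 0 := by
      filter_upwards [hV] with x hx
      have hmem := hle x (min (b - 1) a) (hVD ⟨hx, min_lt_of_left_lt (sub_one_lt b)⟩)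
      rw [map_zero]
      nlinarith [min_le_right (b - 1) a]
    have hφ0 : φ = 0 := hmax.hasFDerivAt_eq_zero φ.hasFDerivAt
    have hzero := hle 0 (min b a - 1) (hVD ⟨mem_of_mem_nhds hV, by grind⟩)
    have hl0' : l = 0 := by
      rw [map_zero] at hzero
      nlinarith [min_le_right b a]
    exact hf0 (ContinuousLinearMap.ext fun p => by simpa [hφ0, hl0'] using hsplit p.1 p.2)
  refine ⟨-(l⁻¹ • φ), fun x s hs => ?_⟩
  have hdiv := (le_div_iff₀ hlpos).2 (by linarith [hle x s hs] : s * l ≤ -φ x + a * l)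
  rw [add_div, mul_div_cancel_right₀ _ hlpos.ne'] at hdiv
  simpa [div_eq_inv_mul] using hdiv

section multiplier

variable {K : Set E} {ρ : ℝ → ℝ} {w u v : ℝ → E} {T : ℝ}

theorem integral_inner_sub_const [CompleteSpace E] (hw : Continuous w) (hv : Integrable v)
    (c : E) : ∫ t in (0 : ℝ)..T, inner ℝ (w t - c) (v t)
      = (∫ t in (0 : ℝ)..T, inner ℝ (w t) (v t)) - inner ℝ c (primitive v T) := by
  simp only [inner_sub_left]
  rw [intervalIntegral.integral_sub (intervalIntegrable_inner hw hv _ _)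
    (intervalIntegrable_inner continuous_const hv _ _)]
  congr 1
  exact (innerSL ℝ c).intervalIntegral_comp_comm hv.intervalIntegrable

theorem convex_setOf_admissible_primitive (hw : Continuous w) :
    Convex ℝ {p : E × ℝ | ∃ v, Admissible K ρ v ∧ primitive v T = p.1 ∧
      p.2 ≤ ∫ t in (0 : ℝ)..T, inner ℝ (w t) (v t)} := by
  rintro ⟨x, s⟩ ⟨v, hv, rfl, hs⟩ ⟨y, t⟩ ⟨v', hv', rfl, ht⟩ α β hα hβ hαβ
  refine ⟨_, hv.convex_comb hv' hα hβ hαβ, ?_, ?_⟩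
  · rw [primitive_add (hv.integrable.fun_smul α) (hv'.integrable.fun_smul β), primitive_smul,
      primitive_smul]
    rfl
  · simp only [inner_add_right, inner_smul_right]
    rw [intervalIntegral.integral_add
      ((intervalIntegrable_inner hw hv.integrable _ _).const_mul α)
      ((intervalIntegrable_inner hw hv'.integrable _ _).const_mul β),
      intervalIntegral.integral_const_mul, intervalIntegral.integral_const_mul]
    exact add_le_add (mul_le_mul_of_nonneg_left hs hα) (mul_le_mul_of_nonneg_left ht hβ)

theorem exists_multiplier [CompleteSpace E] (hρ : Integrable ρ)
    (hρ0 : ∀ t, 0 ≤ ρ t) (hK : Bornology.IsBounded K) (hpos : 0 < primitive ρ T)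
    (hw : Continuous w) {a : ℝ}
    (ha : ∀ v ∈ admissibleLoops K ρ T, ∫ t in (0 : ℝ)..T, inner ℝ (w t) (v t) ≤ a) :
    ∃ c, ∀ v, Admissible K ρ v → ∫ t in (0 : ℝ)..T, inner ℝ (w t - c) (v t) ≤ a := by
  set L := primitive ρ T
  set z := ∫ t in (0 : ℝ)..T, ρ t • w t
  have hconst : ∀ k, ∫ t in (0 : ℝ)..T, inner ℝ (w t) (ρ t • k) = inner ℝ k z := fun k => by
    have hswap : ∀ t, inner ℝ (w t) (ρ t • k) = inner ℝ k (ρ t • w t) := fun t => by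
      rw [inner_smul_right, inner_smul_right, real_inner_comm]
    simp only [hswap]
    exact (innerSL ℝ k).intervalIntegral_comp_comm
      (hρ.intervalIntegrable.smul_continuousOn hw.continuousOn)
  have hscale : Tendsto (fun x : E => L⁻¹ • x) (𝓝 0) (𝓝 0) := by
    simpa using (continuous_const_smul L⁻¹).tendsto (0 : E)
  have hinner : ∀ᶠ k in 𝓝 (0 : E), -1 < inner ℝ k z := by
    have hcont : Continuous fun k : E => inner ℝ k z := by fun_prop
    exact hcont.continuousAt.eventually_const_lt (by simp)
  have hpolar : ∀ᶠ k in 𝓝 (0 : E), k ∈ polarBody K := polarBody_mem_nhds_zero hK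
  have hsub : {x : E | L⁻¹ • x ∈ polarBody K ∧ -1 < inner ℝ (L⁻¹ • x) z} ×ˢ Iio (-1) ⊆
      {p | ∃ v, Admissible K ρ v ∧ primitive v T = p.1 ∧
        p.2 ≤ ∫ t in (0 : ℝ)..T, inner ℝ (w t) (v t)} := by
    rintro ⟨x, s⟩ ⟨⟨hk, hkz⟩, hs⟩
    refine ⟨_, Admissible.smul_const hρ hρ0 hk, ?_, (hs.trans (hkz.trans_eq (hconst _).symm)).le⟩
    exact (intervalIntegral.integral_smul_const ..).trans (smul_inv_smul₀ hpos.ne' x)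
  obtain ⟨φ, hφ⟩ := exists_forall_le_add_of_convex
    (convex_setOf_admissible_primitive (K := K) (ρ := ρ) (T := T) hw)
    (hscale.eventually (hpolar.and hinner)) hsub fun s ⟨v, hv, hclosed, hs⟩ =>
      hs.trans (ha v ⟨hv, hclosed⟩)
  refine ⟨(InnerProductSpace.toDual ℝ E).symm φ, fun v hv => ?_⟩
  rw [integral_inner_sub_const hw hv.integrable, InnerProductSpace.toDual_symm_apply,
    sub_le_iff_le_add']
  exact hφ _ _ ⟨v, hv, rfl, le_rfl⟩

theorem ae_inner_le_of_forall_integral_inner_le (hT : 0 ≤ T) (hw : Continuous w)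
    (hu : Admissible K ρ u)
    (hopt : ∀ v, Admissible K ρ v →
      ∫ t in (0 : ℝ)..T, inner ℝ (w t) (v t) ≤ ∫ t in (0 : ℝ)..T, inner ℝ (w t) (u t))
    (hv : Admissible K ρ v) :
    ∀ᵐ t, t ∈ Ioc 0 T → inner ℝ (w t) (v t) ≤ inner ℝ (w t) (u t) := by
  set s : Set ℝ := {t | 0 < inner ℝ (w t) ((v - u) t)} with hs
  have hdiff : Integrable (v - u) := hv.integrable.sub hu.integrable
  have hsm : NullMeasurableSet s := nullMeasurableSet_lt aemeasurable_const
    (hw.aestronglyMeasurable.inner hdiff.1).aemeasurable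
  have hind : Integrable (s.indicator (v - u)) := hdiff.indicator₀ hsm
  have hadm : Admissible K ρ (fun t => u t + s.indicator (v - u) t) := by
    refine ⟨hu.integrable.fun_add hind, ?_⟩
    filter_upwards [hu.inner_le, hv.inner_le] with t hut hvt x hx
    by_cases ht : t ∈ s
    · simpa [indicator_of_mem ht] using hvt x hx
    · simpa [indicator_of_notMem ht] using hut x hx
  have hnonneg : ∀ t, 0 ≤ inner ℝ (w t) (s.indicator (v - u) t) := fun t => by
    by_cases ht : t ∈ s
    · rw [indicator_of_mem ht]
      exact le_of_lt ht
    · rw [indicator_of_notMem ht, inner_zero_right]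
  have hle := hopt _ hadm
  simp only [inner_add_right] at hle
  rw [intervalIntegral.integral_add (intervalIntegrable_inner hw hu.integrable _ _)
    (intervalIntegrable_inner hw hind _ _)] at hle
  have hzero : ∫ t in (0 : ℝ)..T, inner ℝ (w t) (s.indicator (v - u) t) = 0 :=
    le_antisymm (by linarith) (intervalIntegral.integral_nonneg hT fun t _ => hnonneg t)
  rw [intervalIntegral.integral_eq_zero_iff_of_le_of_nonneg_ae hT (ae_of_all _ hnonneg)
    (intervalIntegrable_inner hw hind _ _)] at hzero
  filter_upwards [(ae_restrict_iff' measurableSet_Ioc).1 hzero] with t ht htm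
  by_contra! hlt
  have hts : t ∈ s := by rwa [hs, mem_ofPred_eq, Pi.sub_apply, inner_sub_right, sub_pos]
  have := ht htm
  rw [indicator_of_mem hts] at this
  exact (ne_of_gt hts) this

theorem ae_inner_eq_mul_gauge [CompleteSpace E] [SecondCountableTopology E] (hT : 0 ≤ T)
    (hρ : Integrable ρ) (hρ0 : ∀ t, 0 ≤ ρ t) (hconv : Convex ℝ K) (hclosed : IsClosed K)
    (h0 : K ∈ 𝓝 0) (hw : Continuous w) (hu : Admissible K ρ u)
    (hopt : ∀ v, Admissible K ρ v →
      ∫ t in (0 : ℝ)..T, inner ℝ (w t) (v t) ≤ ∫ t in (0 : ℝ)..T, inner ℝ (w t) (u t)) :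
    ∀ᵐ t, t ∈ Ioc 0 T → inner ℝ (w t) (u t) = ρ t * gauge K (w t) := by
  have : Nonempty (polarBody K) := ⟨⟨0, zero_mem_polarBody K⟩⟩
  have hdense : ∀ᵐ t, ∀ i : ℕ, t ∈ Ioc 0 T →
      inner ℝ (w t) (ρ t • (TopologicalSpace.denseSeq (polarBody K) i : E))
        ≤ inner ℝ (w t) (u t) :=
    ae_all_iff.2 fun i => ae_inner_le_of_forall_integral_inner_le hT hw hu hopt
      (Admissible.smul_const hρ hρ0 (TopologicalSpace.denseSeq (polarBody K) i).2)
  filter_upwards [hdense, hu.inner_le] with t hdt hut ht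
  have hforall : ∀ k : polarBody K, inner ℝ (w t) (ρ t • (k : E)) ≤ inner ℝ (w t) (u t) := by
    have hcl : IsClosed {k : polarBody K |
        inner ℝ (w t) (ρ t • (k : E)) ≤ inner ℝ (w t) (u t)} :=
      isClosed_le (by fun_prop) continuous_const
    exact fun k => hcl.closure_subset_iff.2 (range_subset_iff.2 fun i => hdt i ht)
      (TopologicalSpace.denseRange_denseSeq (polarBody K) k)
  refine le_antisymm ?_ ?_
  · rw [real_inner_comm]
    exact inner_le_mul_gauge h0 hut (w t)
  · rcases (hρ0 t).eq_or_lt with hρt | hρt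
    · have := hforall ⟨0, zero_mem_polarBody K⟩
      simpa [← hρt] using this
    · rw [← le_div_iff₀' hρt]
      refine gauge_le_of_forall_mem_polarBody_inner_le hconv hclosed (mem_of_mem_nhds h0)
        fun k hk => ?_
      rw [le_div_iff₀' hρt, real_inner_comm, ← inner_smul_right]
      exact hforall ⟨k, hk⟩

end multiplier

/-! ### Clarke duality -/

theorem hasDerivAt_zero_comp_of_lipschitz {F : Type*} [NormedAddCommGroup F] [NormedSpace ℝ F]
    {G : E → F} {C : NNReal} (hG : LipschitzWith C G) {w : ℝ → E} {t : ℝ} (hw : HasDerivAt w 0 t) :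
    HasDerivAt (fun s => G (w s)) 0 t := by
  rw [hasDerivAt_iff_isLittleO] at hw ⊢
  simp only [smul_zero, sub_zero] at hw ⊢
  refine Asymptotics.IsBigO.trans_isLittleO ?_ hw
  exact Asymptotics.IsBigO.of_bound C (Eventually.of_forall fun s => hG.norm_sub_le _ _)

theorem mul_eq_inner_of_hasDerivAt_of_forall_inner_le {G : E → ℝ} {u : E} {a : ℝ}
    (hG : ∀ x, inner ℝ u x ≤ a * G x) {w : ℝ → E} {w' : E} {d t : ℝ}
    (heq : inner ℝ u (w t) = a * G (w t)) (hw : HasDerivAt w w' t)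
    (hGw : HasDerivAt (fun s => G (w s)) d t) : a * d = inner ℝ u w' := by
  have hmin : IsLocalMin (fun s => a * G (w s) - inner ℝ u (w s)) t :=
    Eventually.of_forall fun s => by
      dsimp only
      rw [heq, sub_self, sub_nonneg]
      exact hG (w s)
  have hderiv := (hGw.const_mul a).fun_sub ((hasDerivAt_const t u).inner ℝ hw)
  have := hmin.hasDerivAt_eq_zero hderiv
  rw [inner_zero_left, add_zero] at this
  linarith

theorem eq_zero_of_forall_inner_nonpos {K : Set E} (hK : K ∈ 𝓝 0) {u : E}
    (h : ∀ x ∈ K, inner ℝ u x ≤ 0) : u = 0 := by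
  obtain ⟨r, hr, hrK⟩ := Metric.nhds_basis_closedBall.mem_iff.1 hK
  exact norm_le_zero_iff.1
    (nonpos_of_mul_nonpos_right (mul_norm_le_of_forall_inner_le hr.le hrK h) hr)

theorem action_eq_zero_of_forall_eq {T : ℝ} (hT : 0 ≤ T) {γ : ℝ → PhaseSpace n}
    (h : ∀ t ∈ Icc 0 T, γ t = γ 0) : action T γ = 0 := by
  have hcongr : ∫ t in (0 : ℝ)..T, omega (γ t) (deriv γ t) = ∫ _ in (0 : ℝ)..T, (0 : ℝ) := by
    refine intervalIntegral.integral_congr_ae ?_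
    filter_upwards [Measure.ae_ne volume T] with t htT ht
    rw [uIoc_of_le hT] at ht
    have hconst : γ =ᶠ[𝓝 t] fun _ => γ 0 := by
      filter_upwards [Ioo_mem_nhds ht.1 (lt_of_le_of_ne ht.2 htT)] with s hs
      exact h s (Ioo_subset_Icc_self hs)
    rw [hconst.deriv_eq, deriv_const, omega_eq_inner, inner_zero_right]
  rw [action, hcongr, intervalIntegral.integral_zero, mul_zero]

section Clarke

variable {K : Set (PhaseSpace n)} {ρ : ℝ → ℝ} {u : ℝ → PhaseSpace n} {c : PhaseSpace n} {T : ℝ}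

theorem ae_hasDerivAt_J_primitive_sub (hu : Integrable u) (c : PhaseSpace n) :
    ∀ᵐ t, HasDerivAt (fun t => J (primitive u t) - c) (J (u t)) t := by
  filter_upwards [ae_hasDerivAt_primitive hu] with t ht
  exact (hasDerivAt_J_comp ht).sub_const c

theorem absolutelyContinuousOnInterval_J_primitive_sub (hu : Integrable u) (c : PhaseSpace n) :
    AbsolutelyContinuousOnInterval (fun t => J (primitive u t) - c) 0 T :=
  absolutelyContinuousOnInterval_of_dist_le (C := 1)
    (absolutelyContinuousOnInterval_primitive hu left_mem_uIcc) fun _ _ _ _ => by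
      rw [dist_sub_right]
      exact lipschitzWith_J.dist_le_mul _ _

theorem integral_inner_J_primitive_sub {v : ℝ → PhaseSpace n} (hu : Integrable u)
    (hv : Integrable v) (hvT : primitive v T = 0) (c : PhaseSpace n) :
    ∫ t in (0 : ℝ)..T, inner ℝ (J (primitive u t) - c) (v t) = areaForm T u v := by
  have hcont : Continuous fun t => J (primitive u t) := continuous_J.comp (continuous_primitive hu)
  rw [integral_inner_sub_const hcont hv, hvT, inner_zero_right, sub_zero, areaForm]

theorem action_smul_J_primitive_sub (hu : Integrable u) (huT : primitive u T = 0)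
    (c : PhaseSpace n) (s : ℝ) :
    action T (fun t => s • (J (primitive u t) - c)) = s ^ 2 / 2 * areaForm T u u := by
  have hcongr : ∫ t in (0 : ℝ)..T, omega (s • (J (primitive u t) - c))
        (deriv (fun t => s • (J (primitive u t) - c)) t)
      = ∫ t in (0 : ℝ)..T, s ^ 2 * inner ℝ (J (primitive u t) - c) (u t) := by
    refine intervalIntegral.integral_congr_ae ?_
    filter_upwards [ae_hasDerivAt_J_primitive_sub hu c] with t ht _
    rw [(ht.fun_const_smul s).deriv, omega_eq_inner, map_smul, real_inner_smul_left,
      inner_smul_right, inner_J_J]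
    ring
  rw [action, hcongr, intervalIntegral.integral_const_mul,
    integral_inner_J_primitive_sub hu hu huT]
  ring

theorem exists_gauge_eq_of_ae_inner_eq (hT : 0 ≤ T) (hconv : Convex ℝ K) (h0 : K ∈ 𝓝 0)
    (hu : Admissible K ρ u)
    (hnormal : ∀ᵐ t, t ∈ Ioc 0 T →
      inner ℝ (J (primitive u t) - c) (u t) = ρ t * gauge K (J (primitive u t) - c)) :
    ∃ g, ∀ t ∈ Icc 0 T, gauge K (J (primitive u t) - c) = g := by
  obtain ⟨C, hC⟩ := hconv.lipschitz_gauge h0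
  have hac := absolutelyContinuousOnInterval_comp_of_lipschitz hC
    (absolutelyContinuousOnInterval_J_primitive_sub (T := T) hu.integrable c)
  rw [← uIcc_of_le hT]
  refine hac.const_of_ae_hasDerivAt_zero ?_
  filter_upwards [hnormal, hac.ae_differentiableAt, ae_hasDerivAt_J_primitive_sub hu.integrable c,
    hu.inner_le, Measure.ae_ne volume 0] with t hnt hdiff hderiv hut ht0 ht
  rcases eq_or_ne (ρ t) 0 with hρt | hρt
  · have hzero : u t = 0 := eq_zero_of_forall_inner_nonpos h0 fun x hx => hρt ▸ hut x hx
    rw [hzero, map_zero] at hderiv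
    exact hasDerivAt_zero_comp_of_lipschitz hC hderiv
  · have htIoc : t ∈ Ioc 0 T := by
      rw [uIcc_of_le hT] at ht
      exact ⟨lt_of_le_of_ne ht.1 ht0.symm, ht.2⟩
    have hd := (hdiff ht).hasDerivAt
    have htouch := mul_eq_inner_of_hasDerivAt_of_forall_inner_le (inner_le_mul_gauge h0 hut)
      (by rw [real_inner_comm, hnt htIoc]) hderiv hd
    have hortho : inner ℝ (u t) (J (u t)) = 0 := by
      rw [real_inner_comm]
      linarith [inner_J_comm (u t) (u t)]
    rw [hortho, mul_eq_zero, or_iff_right hρt] at htouch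
    rwa [htouch] at hd

theorem isClosedCharacteristic_of_gauge_eq (hconv : Convex ℝ K) (h0 : K ∈ 𝓝 0) (hT : 0 < T)
    (hρ : MemLp ρ 2 (volume.restrict (Icc 0 T))) (hu : u ∈ admissibleLoops K ρ T)
    (hpos : 0 < areaForm T u u) {g : ℝ} (hg : 0 < g)
    (hnormal : ∀ᵐ t, t ∈ Ioc 0 T → inner ℝ (J (primitive u t) - c) (u t) = ρ t * g)
    (hgauge : ∀ t ∈ Icc 0 T, gauge K (J (primitive u t) - c) = g) :
    IsClosedCharacteristic K T (fun t => g⁻¹ • (J (primitive u t) - c)) := by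
  obtain ⟨r, hr, hrK⟩ := Metric.nhds_basis_closedBall.mem_iff.1 h0
  have hderiv : ∀ᵐ t, HasDerivAt (fun t => g⁻¹ • (J (primitive u t) - c)) (g⁻¹ • J (u t)) t := by
    filter_upwards [ae_hasDerivAt_J_primitive_sub hu.1.integrable c] with t ht
    exact ht.const_smul g⁻¹
  refine ⟨hT, (absolutelyContinuousOnInterval_J_primitive_sub hu.1.integrable c).const_smul g⁻¹,
    ?_, ?_, fun t ht => ?_, ?_, ?_⟩
  · refine hρ.of_le_mul (c := g⁻¹ * r⁻¹) (measurable_deriv _).aestronglyMeasurable ?_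
    refine ae_restrict_of_ae ?_
    filter_upwards [hderiv, hu.1.ae_norm_le hr hrK] with t hβt hut
    rw [hβt.deriv, norm_smul, norm_J, Real.norm_of_nonneg (by positivity), mul_assoc]
    gcongr
    exact hut.trans (by gcongr; exact le_abs_self _)
  · simp only [primitive_zero, hu.2]
  · rw [← gauge_eq_one_iff_mem_frontier hconv h0, gauge_smul_of_nonneg (by positivity),
      hgauge t ht, smul_eq_mul, inv_mul_cancel₀ hg.ne']
  · rw [← Measure.restrict_congr_set Ioc_ae_eq_Icc]
    refine (ae_restrict_iff' measurableSet_Ioc).2 ?_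
    filter_upwards [hderiv, hnormal, hu.1.inner_le] with t hβt hnt hut ht y hy
    rw [hβt.deriv, map_smul, J_J, smul_neg, neg_neg, real_inner_smul_left, inner_sub_right,
      inner_smul_right, real_inner_comm, hnt ht, mul_comm (ρ t), inv_mul_cancel_left₀ hg.ne']
    exact mul_nonneg (by positivity) (sub_nonneg.2 (hut y hy))
  · by_contra! hconst
    have hzero := action_eq_zero_of_forall_eq hT.le hconst
    rw [action_smul_J_primitive_sub hu.1.integrable hu.2] at hzero
    have : 0 < g⁻¹ ^ 2 / 2 * areaForm T u u := by positivity
    exact this.ne' hzero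

theorem primitive_pos_of_areaForm_pos (hT : 0 ≤ T) (hρ : Integrable ρ) (hρ0 : ∀ t, 0 ≤ ρ t)
    (h0 : K ∈ 𝓝 0) (hu : Admissible K ρ u) (hpos : 0 < areaForm T u u) : 0 < primitive ρ T := by
  by_contra! hle
  have hzero : ∀ t ∈ Icc 0 T, primitive u t = 0 := fun t ht => by
    refine eq_zero_of_forall_inner_nonpos h0 fun x hx => ?_
    have hbound := hu.inner_primitive_sub_le hρ ht.1 hx
    have hrest : 0 ≤ primitive ρ T - primitive ρ t := by
      rw [primitive_sub_primitive hρ]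
      exact intervalIntegral.integral_nonneg ht.2 fun s _ => hρ0 s
    rw [primitive_zero, primitive_zero, sub_zero, sub_zero] at hbound
    linarith
  have : areaForm T u u = ∫ _ in (0 : ℝ)..T, (0 : ℝ) :=
    intervalIntegral.integral_congr fun t ht => by
      rw [uIcc_of_le hT] at ht
      rw [hzero t ht, map_zero, inner_zero_left]
  rw [this, intervalIntegral.integral_zero] at hpos
  exact hpos.false

theorem exists_ae_inner_eq_mul_gauge_of_isMaxOn (hT : 0 ≤ T) (hconv : Convex ℝ K)
    (hcomp : IsCompact K) (h0 : K ∈ 𝓝 0) (hρ : Integrable ρ) (hρ0 : ∀ t, 0 ≤ ρ t)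
    (hu : u ∈ admissibleLoops K ρ T)
    (hmax : IsMaxOn (fun u => areaForm T u u) (admissibleLoops K ρ T) u)
    (hpos : 0 < areaForm T u u) :
    ∃ c, ∀ᵐ t, t ∈ Ioc 0 T →
      inner ℝ (J (primitive u t) - c) (u t) = ρ t * gauge K (J (primitive u t) - c) := by
  have hcont : Continuous fun t => J (primitive u t) :=
    continuous_J.comp (continuous_primitive hu.1.integrable)
  obtain ⟨c, hc⟩ := exists_multiplier hρ hρ0 hcomp.isBounded
    (primitive_pos_of_areaForm_pos hT hρ hρ0 h0 hu.1 hpos) hcont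
    fun v hv => areaForm_le_of_isMaxOn hu hmax hv
  refine ⟨c, ae_inner_eq_mul_gauge hT hρ hρ0 hconv hcomp.isClosed h0
    (hcont.sub continuous_const) hu.1 fun v hv => ?_⟩
  rw [integral_inner_J_primitive_sub hu.1.integrable hu.1.integrable hu.2]
  exact hc v hv

theorem exists_isClosedCharacteristic_action_le (hconv : Convex ℝ K) (hcomp : IsCompact K)
    (h0 : K ∈ 𝓝 0) (hT : 0 < T) (hρ : Integrable ρ) (hρ0 : ∀ t, 0 ≤ ρ t)
    (hρ2 : MemLp ρ 2 (volume.restrict (Icc 0 T))) {u₀ : ℝ → PhaseSpace n}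
    (hu₀ : u₀ ∈ admissibleLoops K ρ T) (hpos : 0 < areaForm T u₀ u₀) :
    ∃ β, IsClosedCharacteristic K T β ∧
      action T β * (2 * areaForm T u₀ u₀) ≤ (primitive ρ T) ^ 2 := by
  obtain ⟨u, hu, hmax⟩ := exists_isMaxOn_areaForm hT.le hρ hρ0 h0
  have hle : areaForm T u₀ u₀ ≤ areaForm T u u := hmax hu₀
  have hupos := hpos.trans_le hle
  have hL := primitive_pos_of_areaForm_pos hT.le hρ hρ0 h0 hu.1 hupos
  obtain ⟨c, hnormal⟩ :=
    exists_ae_inner_eq_mul_gauge_of_isMaxOn hT.le hconv hcomp h0 hρ hρ0 hu hmax hupos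
  obtain ⟨g, hgauge⟩ := exists_gauge_eq_of_ae_inner_eq hT.le hconv h0 hu.1 hnormal
  have hnormal' : ∀ᵐ t, t ∈ Ioc 0 T → inner ℝ (J (primitive u t) - c) (u t) = ρ t * g := by
    filter_upwards [hnormal] with t hnt ht
    rw [hnt ht, hgauge t (Ioc_subset_Icc_self ht)]
  have harea : areaForm T u u = g * primitive ρ T := by
    rw [← integral_inner_J_primitive_sub hu.1.integrable hu.1.integrable hu.2 c, primitive,
      ← intervalIntegral.integral_const_mul]
    refine intervalIntegral.integral_congr_ae ?_
    filter_upwards [hnormal'] with t hnt ht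
    rw [hnt (by rwa [uIoc_of_le hT.le] at ht), mul_comm]
  have hg : 0 < g := pos_of_mul_pos_left (harea ▸ hupos) hL.le
  refine ⟨_, isClosedCharacteristic_of_gauge_eq hconv h0 hT hρ2 hu hupos hg hnormal' hgauge, ?_⟩
  rw [action_smul_J_primitive_sub hu.1.integrable hu.2, harea]
  rw [harea] at hle
  calc g⁻¹ ^ 2 / 2 * (g * primitive ρ T) * (2 * areaForm T u₀ u₀)
      = g⁻¹ * primitive ρ T * areaForm T u₀ u₀ := by field_simp
    _ ≤ g⁻¹ * primitive ρ T * (g * primitive ρ T) := by gcongr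
    _ = primitive ρ T ^ 2 := by field_simp

end Clarke

/-! ### The second variation of an action-minimizing closed characteristic -/

/-- The function `-J γ'` on `[0, T]`, extended by zero. -/
noncomputable def normalVelocity (T : ℝ) (γ : ℝ → PhaseSpace n) : ℝ → PhaseSpace n :=
  (Icc 0 T).indicator fun t => -J (deriv γ t)

theorem mem_normalCone_iff {K : Set (PhaseSpace n)} {x v : PhaseSpace n} :
    v ∈ normalCone K x ↔ ∀ y ∈ K, inner ℝ v y ≤ inner ℝ v x := by
  simp only [normalCone, mem_ofPred_eq, inner_sub_right, sub_nonneg]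

theorem integrable_of_memLp_restrict {α F : Type*} [MeasurableSpace α] [NormedAddCommGroup F]
    {μ : Measure α} {s : Set α} [IsFiniteMeasure (μ.restrict s)] {f : α → F} {p : ENNReal}
    (hp : 1 ≤ p) (hf : MemLp f p (μ.restrict s)) (h0 : ∀ t ∉ s, f t = 0) : Integrable f μ :=
  IntegrableOn.integrable_of_forall_notMem_eq_zero (hf.integrable hp) h0

section minimizing

variable {K : Set (PhaseSpace n)} {T : ℝ} {γ δ u : ℝ → PhaseSpace n}

theorem normalVelocity_of_mem {t : ℝ} (ht : t ∈ Icc 0 T) :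
    normalVelocity T γ t = -J (deriv γ t) := indicator_of_mem ht _

theorem normalVelocity_of_notMem {t : ℝ} (ht : t ∉ Icc 0 T) : normalVelocity T γ t = 0 :=
  indicator_of_notMem ht _

theorem measurable_normalVelocity (T : ℝ) (γ : ℝ → PhaseSpace n) :
    Measurable (normalVelocity T γ) :=
  ((continuous_J.measurable.comp (measurable_deriv γ)).neg).indicator measurableSet_Icc

namespace IsClosedCharacteristic

theorem continuousOn (h : IsClosedCharacteristic K T γ) : ContinuousOn γ (Icc 0 T) := by
  simpa only [uIcc_of_le h.period_pos.le] using h.absolutelyContinuous.continuousOn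

theorem normalVelocity_mem_normalCone (h : IsClosedCharacteristic K T γ) :
    ∀ᵐ t, t ∈ Icc 0 T → normalVelocity T γ t ∈ normalCone K (γ t) := by
  filter_upwards [(ae_restrict_iff' measurableSet_Icc).1 h.velocity] with t hvt ht
  rw [normalVelocity_of_mem ht]
  exact hvt ht

theorem memLp_normalVelocity (h : IsClosedCharacteristic K T γ) :
    MemLp (normalVelocity T γ) 2 (volume.restrict (Icc 0 T)) := by
  refine h.deriv_memLp.of_le (measurable_normalVelocity T γ).aestronglyMeasurable ?_
  refine ae_of_all _ fun t => (norm_indicator_le_norm_self _ t).trans ?_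
  rw [norm_neg, norm_J]

theorem integrable_normalVelocity (h : IsClosedCharacteristic K T γ) :
    Integrable (normalVelocity T γ) :=
  integrable_of_memLp_restrict one_le_two h.memLp_normalVelocity
    fun _ ht => normalVelocity_of_notMem ht

theorem J_primitive_normalVelocity (h : IsClosedCharacteristic K T γ) {t : ℝ}
    (ht : t ∈ Icc 0 T) : J (primitive (normalVelocity T γ) t) = γ t - γ 0 := by
  have hT := h.period_pos.le
  have hint := h.integrable_normalVelocity
  have hJint : Integrable fun t => J (normalVelocity T γ t) :=
    JIsometry.toContinuousLinearMap.integrable_comp hint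
  have hprim : ∫ s in (0 : ℝ)..t, J (normalVelocity T γ s)
      = J (primitive (normalVelocity T γ) t) :=
    JIsometry.toContinuousLinearMap.intervalIntegral_comp_comm hint.intervalIntegrable
  have hderiv : ∀ᵐ t, t ∈ uIcc 0 T → HasDerivAt γ (J (normalVelocity T γ t)) t := by
    filter_upwards [h.absolutelyContinuous.boundedVariationOn.ae_differentiableAt_of_mem_uIcc]
      with t hdiff ht
    have hγt := (hdiff ht).hasDerivAt
    rw [uIcc_of_le hT] at ht
    rwa [normalVelocity_of_mem ht, map_neg, J_J, neg_neg]
  have := eq_add_integral_of_ae_hasDerivAt h.absolutelyContinuous hJint.intervalIntegrable hderiv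
    (by rwa [uIcc_of_le hT])
  rw [← hprim, this, add_sub_cancel_left]

theorem primitive_normalVelocity (h : IsClosedCharacteristic K T γ) :
    primitive (normalVelocity T γ) T = 0 := by
  have hJ := h.J_primitive_normalVelocity (t := T) ⟨h.period_pos.le, le_rfl⟩
  rw [← h.closed, sub_self] at hJ
  rw [← norm_eq_zero, ← norm_J, hJ, norm_zero]

theorem integrableOn_inner (h : IsClosedCharacteristic K T γ) (hu : Integrable u) :
    IntegrableOn (fun t => inner ℝ (γ t) (u t)) (Icc 0 T) := by
  obtain ⟨C, hC⟩ := isCompact_Icc.exists_bound_of_continuousOn h.continuousOn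
  exact integrableOn_inner_of_norm_le measurableSet_Icc
    (h.continuousOn.aestronglyMeasurable measurableSet_Icc) hC hu.integrableOn

theorem intervalIntegrable_inner (h : IsClosedCharacteristic K T γ) (hu : Integrable u) :
    IntervalIntegrable (fun t => inner ℝ (γ t) (u t)) volume 0 T :=
  (intervalIntegrable_iff_integrableOn_Icc_of_le h.period_pos.le).2 (h.integrableOn_inner hu)

theorem areaForm_normalVelocity (h : IsClosedCharacteristic K T γ) (hδ : Integrable δ)
    (hδT : primitive δ T = 0) :
    areaForm T (normalVelocity T γ) δ = ∫ t in (0 : ℝ)..T, inner ℝ (γ t) (δ t) := by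
  rw [← integral_inner_J_primitive_sub h.integrable_normalVelocity hδ hδT (-γ 0)]
  refine intervalIntegral.integral_congr fun t ht => ?_
  rw [uIcc_of_le h.period_pos.le] at ht
  rw [h.J_primitive_normalVelocity ht, sub_neg_eq_add, sub_add_cancel]

theorem two_mul_action (h : IsClosedCharacteristic K T γ) :
    2 * action T γ = ∫ t in (0 : ℝ)..T, inner ℝ (γ t) (normalVelocity T γ t) := by
  rw [action, ← mul_assoc, mul_one_div_cancel two_ne_zero, one_mul]
  refine intervalIntegral.integral_congr fun t ht => ?_
  rw [uIcc_of_le h.period_pos.le] at ht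
  rw [normalVelocity_of_mem ht, omega_eq_inner, inner_J_left, inner_neg_right]

theorem ae_inner_nonneg (hK : 0 ∈ K)
    (hu : ∀ᵐ t, t ∈ Icc 0 T → u t ∈ normalCone K (γ t)) :
    ∀ᵐ t, t ∈ Ioc 0 T → 0 ≤ inner ℝ (γ t) (u t) := by
  filter_upwards [hu] with t hut ht
  simpa [real_inner_comm] using
    mem_normalCone_iff.1 (hut (Ioc_subset_Icc_self ht)) 0 hK

theorem action_pos (h : IsClosedCharacteristic K T γ) (hK : K ∈ 𝓝 0) : 0 < action T γ := by
  set v := normalVelocity T γ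
  have hT := h.period_pos.le
  have hnonneg : 0 ≤ᵐ[volume.restrict (Ioc 0 T)] fun t => inner ℝ (γ t) (v t) :=
    (ae_restrict_iff' measurableSet_Ioc).2
      (ae_inner_nonneg (mem_of_mem_nhds hK) h.normalVelocity_mem_normalCone)
  have hint : 0 ≤ ∫ t in (0 : ℝ)..T, inner ℝ (γ t) (v t) :=
    intervalIntegral.integral_nonneg_of_ae_restrict hT
      (by rwa [← Measure.restrict_congr_set Ioc_ae_eq_Icc])
  have haction := h.two_mul_action
  refine lt_of_le_of_ne (by linarith) fun hzero => ?_
  rw [← hzero, mul_zero] at haction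
  have hinner := (ae_restrict_iff' measurableSet_Ioc).1
    ((intervalIntegral.integral_eq_zero_iff_of_le_of_nonneg_ae hT hnonneg
      (h.intervalIntegrable_inner h.integrable_normalVelocity)).1 haction.symm)
  have hv : ∀ᵐ t, t ∈ Ioc 0 T → v t = 0 := by
    filter_upwards [hinner, h.normalVelocity_mem_normalCone] with t ht hvt htm
    refine eq_zero_of_forall_inner_nonpos hK fun x hx => ?_
    have hle := mem_normalCone_iff.1 (hvt (Ioc_subset_Icc_self htm)) x hx
    rwa [real_inner_comm (γ t), ht htm] at hle
  obtain ⟨t, ht, hne⟩ := h.nonconstant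
  refine hne (sub_eq_zero.1 ?_)
  rw [← h.J_primitive_normalVelocity ht, primitive, intervalIntegral.integral_zero_ae, map_zero]
  filter_upwards [hv] with s hs hst
  rw [uIoc_of_le ht.1] at hst
  exact hs ⟨hst.1, hst.2.trans ht.2⟩

theorem memLp_indicator_abs_inner (h : IsClosedCharacteristic K T γ)
    (hu : MemLp u 2 (volume.restrict (Icc 0 T))) (hui : Integrable u) :
    MemLp ((Icc 0 T).indicator fun t => |inner ℝ (γ t) (u t)|) 2 (volume.restrict (Icc 0 T)) := by
  obtain ⟨C, hC⟩ := isCompact_Icc.exists_bound_of_continuousOn h.continuousOn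
  refine hu.of_le_mul (c := C) ((h.integrableOn_inner hui).1.norm.indicator measurableSet_Icc) ?_
  refine (ae_restrict_iff' measurableSet_Icc).2 (ae_of_all _ fun t ht => ?_)
  rw [indicator_of_mem ht, Real.norm_eq_abs, abs_abs]
  exact (abs_real_inner_le_norm _ _).trans (by gcongr; exact hC t ht)

theorem primitive_indicator_abs_inner (h : IsClosedCharacteristic K T γ) (hK : 0 ∈ K)
    (hu : ∀ᵐ t, t ∈ Icc 0 T → u t ∈ normalCone K (γ t)) :
    primitive ((Icc 0 T).indicator fun t => |inner ℝ (γ t) (u t)|) T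
      = ∫ t in (0 : ℝ)..T, inner ℝ (γ t) (u t) := by
  refine intervalIntegral.integral_congr_ae ?_
  filter_upwards [ae_inner_nonneg hK hu] with t hut ht
  rw [uIoc_of_le h.period_pos.le] at ht
  rw [indicator_of_mem (Ioc_subset_Icc_self ht), abs_of_nonneg (hut ht)]

theorem admissible_indicator_abs_inner (hui : Integrable u) (hu0 : ∀ t ∉ Icc 0 T, u t = 0)
    (hu : ∀ᵐ t, t ∈ Icc 0 T → u t ∈ normalCone K (γ t)) :
    Admissible K ((Icc 0 T).indicator fun t => |inner ℝ (γ t) (u t)|) u := by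
  refine ⟨hui, ?_⟩
  filter_upwards [hu] with t hut x hx
  by_cases ht : t ∈ Icc 0 T
  · rw [indicator_of_mem ht, real_inner_comm (u t) (γ t)]
    exact (mem_normalCone_iff.1 (hut ht) x hx).trans (le_abs_self _)
  · rw [indicator_of_notMem ht, hu0 t ht, inner_zero_left]

end IsClosedCharacteristic

namespace IsActionMinimizing

theorem two_mul_action_mul_areaForm_le (hγ : IsActionMinimizing K T γ) (hconv : Convex ℝ K)
    (hcomp : IsCompact K) (hK : K ∈ 𝓝 0) (hu2 : MemLp u 2 (volume.restrict (Icc 0 T)))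
    (hu0 : ∀ t ∉ Icc 0 T, u t = 0) (hu : ∀ᵐ t, t ∈ Icc 0 T → u t ∈ normalCone K (γ t))
    (huT : primitive u T = 0) :
    2 * action T γ * areaForm T u u ≤ (∫ t in (0 : ℝ)..T, inner ℝ (γ t) (u t)) ^ 2 := by
  have hpos := hγ.1.action_pos hK
  rcases le_or_gt (areaForm T u u) 0 with harea | harea
  · exact (mul_nonpos_of_nonneg_of_nonpos (by positivity) harea).trans (sq_nonneg _)
  have hui := integrable_of_memLp_restrict one_le_two hu2 hu0
  have hρ2 := hγ.1.memLp_indicator_abs_inner hu2 hui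
  have hρ := integrable_of_memLp_restrict one_le_two hρ2 fun t ht => indicator_of_notMem ht _
  obtain ⟨β, hβ, hle⟩ := exists_isClosedCharacteristic_action_le hconv hcomp hK hγ.1.period_pos hρ
    (fun t => indicator_nonneg (fun _ _ => abs_nonneg _) t) hρ2
    ⟨IsClosedCharacteristic.admissible_indicator_abs_inner hui hu0 hu, huT⟩ harea
  rw [hγ.1.primitive_indicator_abs_inner (mem_of_mem_nhds hK) hu] at hle
  calc 2 * action T γ * areaForm T u u = action T γ * (2 * areaForm T u u) := by ring
    _ ≤ action T β * (2 * areaForm T u u) := by gcongr; exact hγ.2 T β hβ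
    _ ≤ _ := hle

theorem areaForm_nonpos (hγ : IsActionMinimizing K T γ) (hconv : Convex ℝ K)
    (hcomp : IsCompact K) (hK : K ∈ 𝓝 0) (hδ2 : MemLp δ 2 (volume.restrict (Icc 0 T)))
    (hδ0 : ∀ t ∉ Icc 0 T, δ t = 0)
    (hδN : ∀ᵐ t, t ∈ Icc 0 T → normalVelocity T γ t + δ t ∈ normalCone K (γ t))
    (hδT : primitive δ T = 0) (hδγ : ∫ t in (0 : ℝ)..T, inner ℝ (γ t) (δ t) = 0) :
    areaForm T δ δ ≤ 0 := by
  have h := hγ.1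
  set v := normalVelocity T γ
  have hv : Integrable v := h.integrable_normalVelocity
  have hδ : Integrable δ := integrable_of_memLp_restrict one_le_two hδ2 hδ0
  have hvT : primitive v T = 0 := h.primitive_normalVelocity
  have hle := hγ.two_mul_action_mul_areaForm_le hconv hcomp hK (h.memLp_normalVelocity.add hδ2)
    (fun t ht => by rw [Pi.add_apply, hδ0 t ht, normalVelocity_of_notMem ht, add_zero]) hδN
    ((primitive_add hv hδ T).trans (by rw [hvT, hδT, add_zero]))
  have hlength : ∫ t in (0 : ℝ)..T, inner ℝ (γ t) ((v + δ) t) = 2 * action T γ := by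
    simp only [Pi.add_apply, inner_add_right]
    rw [intervalIntegral.integral_add (h.intervalIntegrable_inner hv)
      (h.intervalIntegrable_inner hδ), hδγ, add_zero, h.two_mul_action]
  have harea : areaForm T (v + δ) (v + δ) = 2 * action T γ + areaForm T δ δ := by
    have hvδ : Integrable fun t => v t + δ t := hv.fun_add hδ
    change areaForm T (fun t => v t + δ t) (fun t => v t + δ t) = _
    rw [areaForm_add_left hv hδ hvδ, areaForm_add_right hv hv hδ, areaForm_add_right hδ hv hδ,
      ← areaForm_comm hv hδ hvT, h.areaForm_normalVelocity hδ hδT, hδγ,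
      h.areaForm_normalVelocity hv hvT, h.two_mul_action]
    ring
  rw [hlength, harea] at hle
  have hpos := h.action_pos hK
  nlinarith

end IsActionMinimizing

end minimizing

/-! ### Small loops -/

section loops

theorem integral_indicator_Ioc {F : Type*} [NormedAddCommGroup F] [NormedSpace ℝ F] {f : ℝ → F}
    {a b c : ℝ} (ha : 0 ≤ a) (hab : a ≤ b) (hbc : b ≤ c) :
    ∫ t in (0 : ℝ)..c, (Ioc a b).indicator f t = ∫ t in a..b, f t := by
  rw [intervalIntegral.integral_of_le (ha.trans (hab.trans hbc)),
    setIntegral_indicator measurableSet_Ioc, inter_eq_right.2 (Ioc_subset_Ioc ha hbc),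
    intervalIntegral.integral_of_le hab]

theorem norm_primitive_le_primitive_norm {F : Type*} [NormedAddCommGroup F] [NormedSpace ℝ F]
    {u : ℝ → F} (hu : Integrable u) {t T : ℝ} (ht : t ∈ Icc 0 T) :
    ‖primitive u t‖ ≤ primitive (fun s => ‖u s‖) T :=
  (intervalIntegral.norm_integral_le_integral_norm ht.1).trans
    (intervalIntegral.integral_mono_interval le_rfl ht.1 ht.2
      (ae_of_all _ fun _ => norm_nonneg _) hu.norm.intervalIntegrable)

theorem primitive_norm_nonneg {F : Type*} [NormedAddCommGroup F] (u : ℝ → F) {T : ℝ}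
    (hT : 0 ≤ T) : 0 ≤ primitive (fun t => ‖u t‖) T :=
  intervalIntegral.integral_nonneg hT fun _ _ => norm_nonneg _

theorem abs_areaForm_le {T : ℝ} {u v : ℝ → PhaseSpace n} (hT : 0 ≤ T) (hu : Integrable u)
    (hv : Integrable v) :
    |areaForm T u v| ≤ primitive (fun t => ‖u t‖) T * primitive (fun t => ‖v t‖) T := by
  rw [areaForm, ← Real.norm_eq_abs, primitive.eq_1 (fun t => ‖v t‖),
    ← intervalIntegral.integral_const_mul]
  refine intervalIntegral.norm_integral_le_of_norm_le hT (ae_of_all _ fun t ht => ?_)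
    (hv.norm.const_mul _).intervalIntegrable
  refine (norm_inner_le_norm _ _).trans ?_
  rw [norm_J]
  gcongr
  exact norm_primitive_le_primitive_norm hu (Ioc_subset_Icc_self ht)

theorem abs_areaForm_add_self_sub_le {T : ℝ} {u v : ℝ → PhaseSpace n} (hT : 0 ≤ T)
    (hu : Integrable u) (hv : Integrable v) :
    |areaForm T (fun t => u t + v t) (fun t => u t + v t) - areaForm T u u| ≤
      primitive (fun t => ‖v t‖) T *
        (primitive (fun t => ‖u t‖) T + primitive (fun t => ‖u t + v t‖) T) := by
  have hexpand : areaForm T (fun t => u t + v t) (fun t => u t + v t) - areaForm T u u =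
      areaForm T u v + areaForm T v (fun t => u t + v t) := by
    rw [areaForm_add_left hu hv (hu.fun_add hv), areaForm_add_right hu hu hv]
    ring
  rw [hexpand, mul_add, mul_comm (primitive _ T) (primitive (fun t => ‖u t‖) T)]
  exact (abs_add_le _ _).trans
    (add_le_add (abs_areaForm_le hT hu hv) (abs_areaForm_le hT hv (hu.fun_add hv)))

/-- The derivative of the profile `x (h - x) / h`, `x = t - τ`, which is even about the midpoint
of `[τ, τ + h]`. -/
noncomputable def evenSpeed (τ h t : ℝ) : ℝ := (h - 2 * (t - τ)) / h

/-- The derivative of the profile `x (h - x) (h - 2 x) / h²`, `x = t - τ`, which is odd about the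
midpoint of `[τ, τ + h]`. -/
noncomputable def oddSpeed (τ h t : ℝ) : ℝ := (h ^ 2 - 6 * (t - τ) * h + 6 * (t - τ) ^ 2) / h ^ 2

variable {T τ h : ℝ}

theorem abs_evenSpeed_le {t : ℝ} (hh : 0 < h) (ht : t ∈ Icc τ (τ + h)) :
    |evenSpeed τ h t| ≤ 1 := by
  rw [evenSpeed, abs_div, abs_of_pos hh, div_le_one hh, abs_le]
  constructor <;> linarith [ht.1, ht.2]

theorem abs_oddSpeed_le {t : ℝ} (hh : 0 < h) (ht : t ∈ Icc τ (τ + h)) :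
    |oddSpeed τ h t| ≤ 1 := by
  have hprod : 0 ≤ (t - τ) * (h - (t - τ)) :=
    mul_nonneg (sub_nonneg.2 ht.1) (by linarith [ht.2])
  rw [oddSpeed, abs_div, abs_of_pos (pow_pos hh 2), div_le_one (pow_pos hh 2), abs_le]
  constructor
  · nlinarith [sq_nonneg (h - 2 * (t - τ))]
  · nlinarith

theorem continuous_evenSpeed (τ h : ℝ) : Continuous (evenSpeed τ h) := by
  unfold evenSpeed; fun_prop

theorem continuous_oddSpeed (τ h : ℝ) : Continuous (oddSpeed τ h) := by
  unfold oddSpeed; fun_prop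

theorem hasDerivAt_evenProfile (τ h t : ℝ) :
    HasDerivAt (fun t => (t - τ) * (h - (t - τ)) / h) (evenSpeed τ h t) t := by
  have hsub : HasDerivAt (fun t => t - τ) 1 t := (hasDerivAt_id t).sub_const τ
  convert! (hsub.fun_mul (hsub.const_sub h)).div_const h using 1
  rw [evenSpeed]; ring

theorem hasDerivAt_oddProfile (τ h t : ℝ) :
    HasDerivAt (fun t => (t - τ) * (h - (t - τ)) * (h - 2 * (t - τ)) / h ^ 2)
      (oddSpeed τ h t) t := by
  have hsub : HasDerivAt (fun t => t - τ) 1 t := (hasDerivAt_id t).sub_const τ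
  convert! ((hsub.fun_mul (hsub.const_sub h)).fun_mul
    ((hsub.const_mul 2).const_sub h)).div_const (h ^ 2) using 1
  rw [oddSpeed]; ring

theorem integrable_indicator_norm_add_norm {F : Type*} [NormedAddCommGroup F] {p q : ℝ → F}
    (hp : LocallyIntegrable p) (hq : LocallyIntegrable q) (a b : ℝ) :
    Integrable ((Ioc a b).indicator fun t => ‖p t‖ + ‖q t‖) := by
  have hi : IntegrableOn (fun t => ‖p t‖ + ‖q t‖) (Icc a b) :=
    (hp.integrableOn_isCompact isCompact_Icc).norm.add
      (hq.integrableOn_isCompact isCompact_Icc).norm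
  exact (integrable_indicator_iff measurableSet_Ioc).2 (hi.mono_set Ioc_subset_Icc_self)

section velocity

variable {F : Type*} [NormedAddCommGroup F] [NormedSpace ℝ F] {p q : ℝ → F}

/-- The velocity of a small path over the interval `(τ, τ + h]` that follows an even profile in
the direction `p` and an odd one in the direction `q`. For constant directions it is a loop, and
the opposite parities make its area a nonzero multiple of `ω p q`. -/
noncomputable def loopVelocity (τ h : ℝ) (p q : ℝ → F) : ℝ → F :=
  (Ioc τ (τ + h)).indicator fun t => evenSpeed τ h t • p t + oddSpeed τ h t • q t

theorem norm_loopVelocity_le (hh : 0 < h) (p q : ℝ → F) (t : ℝ) :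
    ‖loopVelocity τ h p q t‖ ≤ (Ioc τ (τ + h)).indicator (fun t => ‖p t‖ + ‖q t‖) t := by
  rw [loopVelocity, norm_indicator_eq_indicator_norm]
  refine indicator_le_indicator' fun ht => (norm_add_le _ _).trans ?_
  rw [norm_smul, norm_smul]
  exact add_le_add
    (mul_le_of_le_one_left (norm_nonneg _) (abs_evenSpeed_le hh (Ioc_subset_Icc_self ht)))
    (mul_le_of_le_one_left (norm_nonneg _) (abs_oddSpeed_le hh (Ioc_subset_Icc_self ht)))

theorem integrable_loopVelocity (hh : 0 < h) (hp : LocallyIntegrable p)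
    (hq : LocallyIntegrable q) : Integrable (loopVelocity τ h p q) :=
  (integrable_indicator_norm_add_norm hp hq τ (τ + h)).mono'
    ((((continuous_evenSpeed τ h).aestronglyMeasurable.smul hp.aestronglyMeasurable).add
      ((continuous_oddSpeed τ h).aestronglyMeasurable.smul hq.aestronglyMeasurable)).indicator
        measurableSet_Ioc)
    (ae_of_all _ (norm_loopVelocity_le hh p q))

theorem primitive_norm_loopVelocity_le (hh : 0 < h) (hτ : 0 ≤ τ) (hτT : τ + h ≤ T)
    (hp : LocallyIntegrable p) (hq : LocallyIntegrable q) :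
    primitive (fun t => ‖loopVelocity τ h p q t‖) T ≤ ∫ t in τ..(τ + h), (‖p t‖ + ‖q t‖) := by
  rw [← integral_indicator_Ioc hτ (by linarith) hτT]
  exact intervalIntegral.integral_mono (by linarith)
    (integrable_loopVelocity hh hp hq).norm.intervalIntegrable
    (integrable_indicator_norm_add_norm hp hq τ (τ + h)).intervalIntegrable
    (norm_loopVelocity_le hh p q)

theorem primitive_norm_loopVelocity_le_of_norm_le (hh : 0 < h) (hτ : 0 ≤ τ) (hτT : τ + h ≤ T)
    (hp : LocallyIntegrable p) (hq : LocallyIntegrable q) {C : ℝ} (hpC : ∀ t, ‖p t‖ ≤ C)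
    (hqC : ∀ t, ‖q t‖ ≤ C) :
    primitive (fun t => ‖loopVelocity τ h p q t‖) T ≤ 2 * C * h := by
  refine (primitive_norm_loopVelocity_le hh hτ hτT hp hq).trans ?_
  have hle := intervalIntegral.norm_integral_le_of_norm_le_const (a := τ) (b := τ + h)
    (f := fun t => ‖p t‖ + ‖q t‖) (C := 2 * C) fun t _ => by
      rw [Real.norm_of_nonneg (by positivity)]
      linarith [hpC t, hqC t]
  rw [add_sub_cancel_left, abs_of_pos hh] at hle
  exact (Real.le_norm_self _).trans hle

theorem loopVelocity_eq_add (τ h : ℝ) (p q p' q' : ℝ → F) :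
    loopVelocity τ h p q = fun t => loopVelocity τ h p' q' t +
      loopVelocity τ h (fun t => p t - p' t) (fun t => q t - q' t) t := by
  ext t
  by_cases ht : t ∈ Ioc τ (τ + h)
  · simp only [loopVelocity, indicator_of_mem ht]
    module
  · simp only [loopVelocity, indicator_of_notMem ht, add_zero]

theorem primitive_loopVelocity_const_of_mem [CompleteSpace F] (hτ : 0 ≤ τ) (P Q : F) {t : ℝ}
    (ht : t ∈ Icc τ (τ + h)) :
    primitive (loopVelocity τ h (fun _ => P) fun _ => Q) t =
      ((t - τ) * (h - (t - τ)) / h) • P +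
        ((t - τ) * (h - (t - τ)) * (h - 2 * (t - τ)) / h ^ 2) • Q := by
  have hind : primitive (loopVelocity τ h (fun _ => P) fun _ => Q) t =
      ∫ s in τ..t, (evenSpeed τ h s • P + oddSpeed τ h s • Q) := by
    rw [← integral_indicator_Ioc hτ ht.1 le_rfl]
    refine intervalIntegral.integral_congr fun s hs => ?_
    rw [uIcc_of_le (hτ.trans ht.1)] at hs
    simp [loopVelocity, indicator, hs.2, hs.2.trans ht.2]
  rw [hind, intervalIntegral.integral_eq_sub_of_hasDerivAt
    (fun s _ => ((hasDerivAt_evenProfile τ h s).smul_const P).fun_add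
      ((hasDerivAt_oddProfile τ h s).smul_const Q))]
  · simp
  · exact (((continuous_evenSpeed τ h).smul continuous_const).add
      ((continuous_oddSpeed τ h).smul continuous_const)).intervalIntegrable _ _

theorem primitive_loopVelocity_eq_of_le (hh : 0 < h) (hτ : 0 ≤ τ) (hτT : τ + h ≤ T)
    (p q : ℝ → F) :
    primitive (loopVelocity τ h p q) T = primitive (loopVelocity τ h p q) (τ + h) := by
  rw [primitive, primitive, loopVelocity, integral_indicator_Ioc hτ (by linarith) hτT,
    integral_indicator_Ioc hτ (by linarith) le_rfl]

theorem primitive_loopVelocity_const [CompleteSpace F] (hh : 0 < h) (hτ : 0 ≤ τ)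
    (hτT : τ + h ≤ T) (P Q : F) :
    primitive (loopVelocity τ h (fun _ => P) fun _ => Q) T = 0 := by
  rw [primitive_loopVelocity_eq_of_le hh hτ hτT,
    primitive_loopVelocity_const_of_mem hτ P Q (right_mem_Icc.2 (by linarith))]
  simp

theorem norm_primitive_loopVelocity_le [CompleteSpace F] (hh : 0 < h) (hτ : 0 ≤ τ)
    (hτT : τ + h ≤ T) (hp : LocallyIntegrable p) (hq : LocallyIntegrable q) :
    ‖primitive (loopVelocity τ h p q) T‖ ≤
      ∫ t in τ..(τ + h), (‖p t - p τ‖ + ‖q t - q τ‖) := by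
  have hpτ : LocallyIntegrable fun _ : ℝ => p τ := locallyIntegrable_const _
  have hqτ : LocallyIntegrable fun _ : ℝ => q τ := locallyIntegrable_const _
  have hpd : LocallyIntegrable fun t => p t - p τ := hp.sub hpτ
  have hqd : LocallyIntegrable fun t => q t - q τ := hq.sub hqτ
  rw [loopVelocity_eq_add τ h p q (fun _ => p τ) (fun _ => q τ),
    primitive_add (integrable_loopVelocity hh hpτ hqτ)
      (integrable_loopVelocity hh hpd hqd),
    primitive_loopVelocity_const hh hτ hτT, zero_add]
  exact (norm_primitive_le_primitive_norm
      (integrable_loopVelocity hh hpd hqd)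
      (right_mem_Icc.2 (by linarith))).trans
    (primitive_norm_loopVelocity_le hh hτ hτT hpd hqd)

end velocity

theorem integral_sq_mul_sub_sq (h : ℝ) :
    ∫ x in (0 : ℝ)..h, x ^ 2 * (h - x) ^ 2 = h ^ 5 / 30 := by
  have hexpand : ∀ x : ℝ, x ^ 2 * (h - x) ^ 2 = h ^ 2 * x ^ 2 - 2 * h * x ^ 3 + x ^ 4 :=
    fun x => by ring
  simp only [hexpand]
  rw [intervalIntegral.integral_add, intervalIntegral.integral_sub,
    intervalIntegral.integral_const_mul, intervalIntegral.integral_const_mul, integral_pow,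
    integral_pow, integral_pow]
  · norm_num; ring
  all_goals exact Continuous.intervalIntegrable (by fun_prop) _ _

theorem areaForm_loopVelocity_const (hh : 0 < h) (hτ : 0 ≤ τ) (hτT : τ + h ≤ T)
    (P Q : PhaseSpace n) :
    areaForm T (loopVelocity τ h (fun _ => P) fun _ => Q)
      (loopVelocity τ h (fun _ => P) fun _ => Q) = -(h ^ 2 / 15) * omega P Q := by
  have hintegrand : ∀ t, inner ℝ (J (primitive (loopVelocity τ h (fun _ => P) fun _ => Q) t))
      (loopVelocity τ h (fun _ => P) (fun _ => Q) t) = (Ioc τ (τ + h)).indicator (fun t =>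
        (t - τ) ^ 2 * (h - (t - τ)) ^ 2 * (-(2 / h ^ 3) * omega P Q)) t := by
    intro t
    by_cases ht : t ∈ Ioc τ (τ + h)
    · rw [primitive_loopVelocity_const_of_mem hτ P Q (Ioc_subset_Icc_self ht), loopVelocity,
        indicator_of_mem ht, indicator_of_mem ht]
      have hP : inner ℝ (J P) P = 0 := self_eq_neg.1 (inner_J_comm P P)
      have hQ : inner ℝ (J Q) Q = 0 := self_eq_neg.1 (inner_J_comm Q Q)
      simp only [map_add, map_smul, inner_add_left, inner_add_right, real_inner_smul_left,
        inner_smul_right, hP, hQ, inner_J_comm Q P, omega_eq_inner, evenSpeed, oddSpeed]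
      field_simp
      ring
    · rw [loopVelocity, indicator_of_notMem ht, indicator_of_notMem ht, inner_zero_right]
  rw [areaForm]
  simp only [hintegrand]
  rw [integral_indicator_Ioc hτ (by linarith) hτT, intervalIntegral.integral_mul_const,
    intervalIntegral.integral_comp_sub_right (fun x => x ^ 2 * (h - x) ^ 2), sub_self,
    add_sub_cancel_left, integral_sq_mul_sub_sq]
  field_simp
  ring

theorem abs_areaForm_loopVelocity_add_le (hh : 0 < h) (hτ : 0 ≤ τ) (hτT : τ + h ≤ T)
    {p q : ℝ → PhaseSpace n} (hp : LocallyIntegrable p) (hq : LocallyIntegrable q) {C : ℝ}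
    (hpC : ∀ t, ‖p t‖ ≤ C) (hqC : ∀ t, ‖q t‖ ≤ C) :
    |areaForm T (loopVelocity τ h p q) (loopVelocity τ h p q) + h ^ 2 / 15 * omega (p τ) (q τ)| ≤
      (∫ t in τ..(τ + h), (‖p t - p τ‖ + ‖q t - q τ‖)) * (4 * C * h) := by
  have hT : 0 ≤ T := by linarith
  have hpτ : LocallyIntegrable fun _ : ℝ => p τ := locallyIntegrable_const _
  have hqτ : LocallyIntegrable fun _ : ℝ => q τ := locallyIntegrable_const _
  have hpd : LocallyIntegrable fun t => p t - p τ := hp.sub hpτ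
  have hqd : LocallyIntegrable fun t => q t - q τ := hq.sub hqτ
  set u := loopVelocity τ h (fun _ => p τ) fun _ => q τ with hu
  set v := loopVelocity τ h (fun t => p t - p τ) (fun t => q t - q τ) with hv
  have hsplit : loopVelocity τ h p q = fun t => u t + v t := loopVelocity_eq_add τ h p q _ _
  have hsum := primitive_norm_loopVelocity_le_of_norm_le hh hτ hτT hp hq hpC hqC
  have hconst := primitive_norm_loopVelocity_le_of_norm_le hh hτ hτT hpτ hqτ
    (fun _ => hpC τ) (fun _ => hqC τ)
  have hdiff := primitive_norm_loopVelocity_le hh hτ hτT hpd hqd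
  have hle := abs_areaForm_add_self_sub_le hT (integrable_loopVelocity (τ := τ) hh hpτ hqτ)
    (integrable_loopVelocity (τ := τ) hh hpd hqd)
  rw [← hu, ← hv] at hle
  rw [hsplit] at hsum ⊢
  rw [areaForm_loopVelocity_const hh hτ hτT, neg_mul, sub_neg_eq_add] at hle
  refine hle.trans (mul_le_mul hdiff (by linarith) ?_ ((primitive_norm_nonneg v hT).trans hdiff))
  exact add_nonneg (primitive_norm_nonneg u hT) (primitive_norm_nonneg _ hT)

theorem primitive_loopVelocity_of_le {F : Type*} [NormedAddCommGroup F] [NormedSpace ℝ F]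
    (p q : ℝ → F) {t : ℝ} (ht : t ∈ Icc 0 τ) : primitive (loopVelocity τ h p q) t = 0 := by
  refine intervalIntegral.integral_zero_ae (ae_of_all _ fun s hs => indicator_of_notMem ?_ _)
  rw [uIoc_of_le ht.1] at hs
  exact fun hs' => (hs.2.trans ht.2).not_gt hs'.1

theorem areaForm_loopVelocity_eq_zero {τ' : ℝ} (hT : 0 ≤ T) (hτ : τ' + h ≤ τ)
    (p q : ℝ → PhaseSpace n) :
    areaForm T (loopVelocity τ h p q) (loopVelocity τ' h p q) = 0 := by
  refine intervalIntegral.integral_zero_ae (ae_of_all _ fun t ht => ?_)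
  rw [uIoc_of_le hT] at ht
  by_cases htτ : t ∈ Ioc τ' (τ' + h)
  · rw [primitive_loopVelocity_of_le p q ⟨ht.1.le, htτ.2.trans hτ⟩, map_zero, inner_zero_left]
  · rw [loopVelocity, loopVelocity, indicator_of_notMem htτ, inner_zero_right]

theorem abs_areaForm_loopVelocity_le {τ' ε : ℝ} (hT : 0 ≤ T) {p q : ℝ → PhaseSpace n}
    (hi : Integrable (loopVelocity τ h p q)) (hi' : Integrable (loopVelocity τ' h p q))
    (hsep : h ≤ |τ - τ'|) (hε : ‖primitive (loopVelocity τ h p q) T‖ ≤ ε)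
    (hε' : ‖primitive (loopVelocity τ' h p q) T‖ ≤ ε) :
    |areaForm T (loopVelocity τ h p q) (loopVelocity τ' h p q)| ≤ ε ^ 2 := by
  rcases le_abs.1 hsep with hsep | hsep
  · rw [areaForm_loopVelocity_eq_zero hT (by linarith), abs_zero]
    exact sq_nonneg ε
  · have hsub := areaForm_sub_areaForm (T := T) hi hi'
    rw [areaForm_loopVelocity_eq_zero (τ := τ') hT (by linarith), sub_zero] at hsub
    rw [hsub, sq]
    refine (abs_real_inner_le_norm _ _).trans ?_
    rw [norm_J]
    exact mul_le_mul hε hε' (norm_nonneg _) ((norm_nonneg _).trans hε)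

/-- `τ` is a Lebesgue point of `p` from the right: the mean of `‖p - p τ‖` over `[τ, τ + h]` tends
to `0` as `h → 0⁺`. -/
def IsRightLebesguePoint {F : Type*} [NormedAddCommGroup F] (p : ℝ → F) (τ : ℝ) : Prop :=
  ∀ κ > 0, ∀ᶠ h in 𝓝[>] (0 : ℝ), ∫ t in τ..(τ + h), ‖p t - p τ‖ ≤ κ * h

theorem ae_isRightLebesguePoint {F : Type*} [NormedAddCommGroup F] {p : ℝ → F}
    (hp : LocallyIntegrable p) : ∀ᵐ τ, IsRightLebesguePoint p τ := by
  filter_upwards [(IsUnifLocDoublingMeasure.vitaliFamily volume 1).ae_tendsto_average_norm_sub hp]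
    with τ hτ κ hκ
  have hshift : Tendsto (fun h => τ + h) (𝓝[>] (0 : ℝ)) (𝓝[>] τ) := by
    have := (continuous_const_add τ).tendsto (0 : ℝ)
    rw [add_zero] at this
    exact tendsto_nhdsWithin_iff.2 ⟨this.mono_left nhdsWithin_le_nhds,
      eventually_mem_nhdsWithin.mono fun h hh => lt_add_of_pos_right τ hh⟩
  filter_upwards [((hτ.comp τ.tendsto_Icc_vitaliFamily_right).comp hshift).eventually_le_const hκ,
    self_mem_nhdsWithin] with h hle (hh : 0 < h)
  simp only [Function.comp_apply, setAverage_eq, measureReal_def, Real.volume_Icc,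
    add_sub_cancel_left, ENNReal.toReal_ofReal hh.le, smul_eq_mul] at hle
  rw [intervalIntegral.integral_of_le (by linarith), ← integral_Icc_eq_integral_Ioc]
  rwa [inv_mul_le_iff₀ hh, mul_comm] at hle

end loops

/-! ### Minimal faces of a cone -/

section faces

variable {V : Type*}

section cone

variable [AddCommGroup V] {N : Set V} {v w : V}

/-- The vectors `w` such that the segment `[v - w, v + w]` lies in `N`. For a convex cone these
span the smallest face through `v`. -/
def faceDirections (N : Set V) (v : V) : Set V :=
  {w | v + w ∈ N ∧ v - w ∈ N}

theorem neg_mem_faceDirections (hw : w ∈ faceDirections N v) : -w ∈ faceDirections N v :=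
  ⟨by simpa [sub_eq_add_neg] using hw.2, by simpa using hw.1⟩

theorem zero_mem_faceDirections (hv : v ∈ N) : 0 ∈ faceDirections N v :=
  ⟨by simpa using hv, by simpa using hv⟩

variable [Module ℝ V] {C : PointedCone ℝ V}

/-- The smallest extreme face of the convex cone `N` that contains `v`. -/
def minimalFace (N : Set V) (v : V) : Set V :=
  (Submodule.span ℝ (faceDirections N v) : Set V) ∩ N

theorem convex_faceDirections (hN : Convex ℝ N) (v : V) : Convex ℝ (faceDirections N v) := by
  intro w hw w' hw' a b ha hb hab
  have hv : a • v + b • v = v := by rw [← add_smul, hab, one_smul]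
  constructor
  · convert! hN hw.1 hw'.1 ha hb hab using 1
    rw [smul_add, smul_add, add_add_add_comm, hv]
  · convert! hN hw.2 hw'.2 ha hb hab using 1
    rw [smul_sub, smul_sub, sub_add_sub_comm, hv]

theorem smul_mem_faceDirections (hN : Convex ℝ N) (hw : w ∈ faceDirections N v) {c : ℝ}
    (hc : |c| ≤ 1) : c • w ∈ faceDirections N v := by
  obtain ⟨hc₁, hc₂⟩ := abs_le.1 hc
  convert! convex_faceDirections hN v hw (neg_mem_faceDirections hw)
    (a := (1 + c) / 2) (b := (1 - c) / 2) (by linarith) (by linarith) (by ring) using 1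
  module

theorem exists_smul_mem_faceDirections (hN : Convex ℝ N) (hv : v ∈ N)
    (hw : w ∈ Submodule.span ℝ (faceDirections N v)) :
    ∃ c : ℝ, 0 < c ∧ c • w ∈ faceDirections N v := by
  induction hw using Submodule.span_induction with
  | mem w hw => exact ⟨1, one_pos, by rwa [one_smul]⟩
  | zero => exact ⟨1, one_pos, by rw [smul_zero]; exact zero_mem_faceDirections hv⟩
  | add w w' _ _ hw hw' =>
    obtain ⟨c, hc, hcw⟩ := hw
    obtain ⟨c', hc', hcw'⟩ := hw'
    refine ⟨c * c' / (c + c'), by positivity, ?_⟩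
    convert! convex_faceDirections hN v hcw hcw' (a := c' / (c + c')) (b := c / (c + c'))
      (by positivity) (by positivity) (by field_simp; ring) using 1
    module
  | smul a w _ hw =>
    obtain ⟨c, hc, hcw⟩ := hw
    refine ⟨c / (|a| + 1), by positivity, ?_⟩
    have hscale : |a / (|a| + 1)| ≤ 1 := by
      rw [abs_div, abs_of_pos (by positivity : 0 < |a| + 1), div_le_one (by positivity)]
      linarith
    convert! smul_mem_faceDirections hN hcw hscale using 1
    module

theorem add_smul_add_smul_mem (hN : Convex ℝ N) {w' : V} (hw : w ∈ faceDirections N v)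
    (hw' : w' ∈ faceDirections N v) {a b : ℝ} (ha : |a| ≤ 1 / 2) (hb : |b| ≤ 1 / 2) :
    v + (a • w + b • w') ∈ N := by
  have hscale : ∀ {c : ℝ}, |c| ≤ 1 / 2 → |2 * c| ≤ 1 := fun hc => by
    rw [abs_mul, abs_two]; linarith
  convert! (convex_faceDirections hN v (smul_mem_faceDirections hN hw (hscale ha))
    (smul_mem_faceDirections hN hw' (hscale hb)) (a := 1 / 2) (b := 1 / 2)
    (by norm_num) (by norm_num) (by norm_num)).1 using 2
  module

theorem self_mem_faceDirections (hv : v ∈ C) : v ∈ faceDirections (C : Set V) v :=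
  ⟨add_mem hv hv, by rw [sub_self]; exact zero_mem C⟩

theorem self_mem_minimalFace (hv : v ∈ C) : v ∈ minimalFace (C : Set V) v :=
  ⟨Submodule.subset_span (self_mem_faceDirections hv), hv⟩

theorem zero_mem_minimalFace (C : PointedCone ℝ V) (v : V) : 0 ∈ minimalFace (C : Set V) v :=
  ⟨zero_mem _, zero_mem C⟩

theorem span_minimalFace (hv : v ∈ C) :
    Submodule.span ℝ (minimalFace (C : Set V) v) =
      Submodule.span ℝ (faceDirections (C : Set V) v) := by
  refine le_antisymm (Submodule.span_le.2 inter_subset_left) (Submodule.span_le.2 fun w hw => ?_)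
  have hvw : v + w ∈ minimalFace (C : Set V) v :=
    ⟨add_mem (Submodule.subset_span (self_mem_faceDirections hv)) (Submodule.subset_span hw), hw.1⟩
  have hsub := sub_mem (Submodule.subset_span (R := ℝ) hvw)
    (Submodule.subset_span (self_mem_minimalFace hv))
  rwa [add_sub_cancel_left] at hsub

theorem isExtreme_minimalFace (hv : v ∈ C) : IsExtreme ℝ (C : Set V) (minimalFace C v) := by
  refine ⟨inter_subset_right, ?_⟩
  rintro y hy z hz _ ⟨hu, -⟩ ⟨a, b, ha, hb, -, rfl⟩
  obtain ⟨c, hc, hcu⟩ := exists_smul_mem_faceDirections C.convex hv hu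
  have hay : (c * a) • y ∈ faceDirections (C : Set V) v := by
    refine ⟨add_mem hv (C.smul_mem (by positivity) hy), ?_⟩
    convert! add_mem hcu.2 (C.smul_mem (by positivity : 0 ≤ c * b) hz) using 1
    module
  refine ⟨?_, hy⟩
  have hy' := Submodule.smul_mem _ (c * a)⁻¹ (Submodule.subset_span (R := ℝ) hay)
  rwa [inv_smul_smul₀ (by positivity)] at hy'

end cone

section relativeInterior

variable [NormedAddCommGroup V] [NormedSpace ℝ V] [FiniteDimensional ℝ V]

theorem preimage_coe_span_mem_nhds_zero {s : Set V} (hs : Convex ℝ s) (hzero : 0 ∈ s)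
    (hneg : ∀ w ∈ s, -w ∈ s) : ((↑) ⁻¹' s : Set (Submodule.span ℝ s)) ∈ 𝓝 0 := by
  set s' : Set (Submodule.span ℝ s) := (↑) ⁻¹' s with hs'
  have hs'conv : Convex ℝ s' := hs.linear_preimage (Submodule.span ℝ s).subtype
  have hspan : affineSpan ℝ s' = ⊤ := by
    rw [← insert_eq_of_mem (show (0 : Submodule.span ℝ s) ∈ s' from hzero)]
    apply SetLike.coe_injective
    rw [affineSpan_insert_zero, hs', Submodule.span_span_coe_preimage]
    rfl
  obtain ⟨x, hx⟩ := hs'conv.interior_nonempty_iff_affineSpan_eq_top.2 hspan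
  have hneg' : -s' = s' := by
    ext w
    exact ⟨fun hw => show (w : V) ∈ s by simpa using hneg _ hw, fun hw => hneg _ hw⟩
  have hx' : -x ∈ interior s' := by
    rw [← hneg']
    exact (preimage_interior_subset_interior_preimage continuous_neg) (by simpa using hx)
  have hmid := hs'conv.interior.midpoint_mem hx hx'
  rw [midpoint_self_neg] at hmid
  exact mem_interior_iff_mem_nhds.1 hmid

theorem self_mem_intrinsicInterior_minimalFace {C : PointedCone ℝ V} {v : V} (hv : v ∈ C) :
    v ∈ intrinsicInterior ℝ (minimalFace (C : Set V) v) := by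
  set W := Submodule.span ℝ (faceDirections (C : Set V) v)
  have hvW : v ∈ W := Submodule.subset_span (self_mem_faceDirections hv)
  have hspan : affineSpan ℝ (minimalFace (C : Set V) v) ≤ W.toAffineSubspace :=
    affineSpan_le.2 inter_subset_left
  have hdisp : ∀ z : affineSpan ℝ (minimalFace (C : Set V) v), (z : V) - v ∈ W :=
    fun z => sub_mem (hspan z.2) hvW
  rw [mem_intrinsicInterior]
  refine ⟨⟨v, subset_affineSpan ℝ _ (self_mem_minimalFace hv)⟩, ?_, rfl⟩
  rw [mem_interior_iff_mem_nhds]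
  have hcont : Continuous fun z : affineSpan ℝ (minimalFace (C : Set V) v) =>
      (⟨z - v, hdisp z⟩ : W) := by fun_prop
  have hnhds := preimage_coe_span_mem_nhds_zero (convex_faceDirections C.convex v)
    (zero_mem_faceDirections hv) fun w => neg_mem_faceDirections
  rw [← (Subtype.ext (sub_self v) : (⟨v - v, sub_mem hvW hvW⟩ : W) = 0)] at hnhds
  filter_upwards [hcont.continuousAt.preimage_mem_nhds hnhds] with z hz
  exact ⟨hspan z.2, by simpa using hz.1⟩

end relativeInterior

section dimension

variable [NormedAddCommGroup V] [InnerProductSpace ℝ V] {C : PointedCone ℝ V} {v : V}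

theorem span_faceDirections_eq_span_singleton (hv : v ∈ C)
    (h : faceDirections (C : Set V) v ⊆ Submodule.span ℝ {v}) :
    Submodule.span ℝ (faceDirections (C : Set V) v) = Submodule.span ℝ {v} :=
  le_antisymm (Submodule.span_le.2 h)
    (Submodule.span_mono (singleton_subset_iff.2 (self_mem_faceDirections hv)))

theorem one_lt_finrank_span_faceDirections_iff [FiniteDimensional ℝ V] (hv : v ∈ C) (hv0 : v ≠ 0) :
    1 < Module.finrank ℝ (Submodule.span ℝ (faceDirections (C : Set V) v)) ↔
      ∃ w ∈ faceDirections (C : Set V) v, ‖inner ℝ v w‖ ≠ ‖v‖ * ‖w‖ := by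
  have hpar : ∀ w, ‖inner ℝ v w‖ = ‖v‖ * ‖w‖ ↔ w ∈ Submodule.span ℝ {v} := fun w =>
    ((norm_inner_eq_norm_tfae ℝ v w).out 0 3).trans (or_iff_right hv0)
  simp only [ne_eq, hpar]
  constructor
  · intro hfin
    by_contra! hall
    rw [span_faceDirections_eq_span_singleton hv hall, finrank_span_singleton hv0] at hfin
    exact hfin.ne rfl
  · rintro ⟨w, hw, hwv⟩
    rw [← finrank_span_singleton (K := ℝ) hv0]
    exact Submodule.finrank_lt_finrank_of_lt (SetLike.lt_iff_le_and_exists.2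
      ⟨Submodule.span_mono (singleton_subset_iff.2 (self_mem_faceDirections hv)),
        w, Submodule.subset_span hw, hwv⟩)

end dimension

section extremeRay

variable [NormedAddCommGroup V] [NormedSpace ℝ V]

theorem faceDirections_subset_span_of_mem_extremePoints {C : PointedCone ℝ V}
    {l : V →ₗ[ℝ] ℝ} (hl : ∀ w ∈ C, 0 ≤ l w) {e : V}
    (he : e ∈ extremePoints ℝ ((C : Set V) ∩ {w | l w = 1})) :
    faceDirections (C : Set V) e ⊆ Submodule.span ℝ {e} := by
  intro w hw
  obtain ⟨⟨heC, hel : l e = 1⟩, hext⟩ := mem_extremePoints.1 he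
  have hadd := hl _ hw.1
  have hsub := hl _ hw.2
  rw [map_add, hel] at hadd
  rw [map_sub, hel] at hsub
  -- Removing from `w` its component along `e` makes the displaced points lie in the base.
  set d : V := (1 / 2 : ℝ) • (w - l w • e) with hd
  have hld : l d = 0 := by simp [hd, hel]
  have hp : e + d ∈ (C : Set V) ∩ {w | l w = 1} := by
    refine ⟨?_, by simp [hel, hld]⟩
    convert! add_mem (C.smul_mem (by norm_num : (0 : ℝ) ≤ 1 / 2) hw.1)
      (C.smul_mem (by linarith : 0 ≤ (1 - l w) / 2) heC) using 1
    module
  have hm : e - d ∈ (C : Set V) ∩ {w | l w = 1} := by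
    refine ⟨?_, by simp [hel, hld]⟩
    convert! add_mem (C.smul_mem (by norm_num : (0 : ℝ) ≤ 1 / 2) hw.2)
      (C.smul_mem (by linarith : 0 ≤ (1 + l w) / 2) heC) using 1
    module
  have hseg : e ∈ openSegment ℝ (e + d) (e - d) :=
    ⟨1 / 2, 1 / 2, by norm_num, by norm_num, by norm_num, by module⟩
  have hd0 : d = 0 := by simpa using (hext _ hp _ hm hseg).1
  refine Submodule.mem_span_singleton.2 ⟨l w, (sub_eq_zero.1 ?_).symm⟩
  simpa [hd] using hd0

theorem exists_faceDirections_subset_span_singleton [ProperSpace V] {C : PointedCone ℝ V}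
    (hC : IsClosed (C : Set V)) {u : V} (hu : u ∈ C) (hu0 : u ≠ 0) {l : V →L[ℝ] ℝ} {r : ℝ}
    (hr : 0 < r) (hl : ∀ w ∈ C, r * ‖w‖ ≤ l w) :
    ∃ e ∈ C, e ≠ 0 ∧ faceDirections (C : Set V) e ⊆ Submodule.span ℝ {e} := by
  set B : Set V := (C : Set V) ∩ {w | l w = 1}
  have hBcomp : IsCompact B := by
    refine (isCompact_closedBall (0 : V) r⁻¹).of_isClosed_subset
      (hC.inter (isClosed_eq l.continuous continuous_const)) fun w ⟨hwC, (hwl : l w = 1)⟩ => ?_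
    rw [mem_closedBall_zero_iff, ← one_div, le_div_iff₀' hr, ← hwl]
    exact hl w hwC
  have hlu : 0 < l u := (mul_pos hr (norm_pos_iff.2 hu0)).trans_le (hl u hu)
  have hBne : B.Nonempty :=
    ⟨(l u)⁻¹ • u, C.smul_mem (inv_nonneg.2 hlu.le) hu, by simp [hlu.ne']⟩
  obtain ⟨e, he⟩ := hBcomp.extremePoints_nonempty hBne
  refine ⟨e, he.1.1, ?_, faceDirections_subset_span_of_mem_extremePoints (l := l.toLinearMap)
    (fun w hw => (by positivity : 0 ≤ r * ‖w‖).trans (hl w hw)) he⟩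
  rintro rfl
  simpa using he.1.2

end extremeRay

end faces

section normalCone

variable {K : Set (PhaseSpace n)} {x v : PhaseSpace n}

/-- The normal cone as a bundled convex cone. -/
def normalPointedCone (K : Set (PhaseSpace n)) (x : PhaseSpace n) :
    PointedCone ℝ (PhaseSpace n) where
  carrier := normalCone K x
  add_mem' hv hw y hy := by
    rw [inner_add_left]
    exact add_nonneg (hv y hy) (hw y hy)
  zero_mem' y _ := by rw [inner_zero_left]
  smul_mem' c v hv y hy := by
    change 0 ≤ inner ℝ ((c : ℝ) • v) (x - y)
    rw [real_inner_smul_left]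
    exact mul_nonneg c.2 (hv y hy)

theorem coe_normalPointedCone (K : Set (PhaseSpace n)) (x : PhaseSpace n) :
    (normalPointedCone K x : Set (PhaseSpace n)) = normalCone K x :=
  rfl

theorem convex_normalCone (K : Set (PhaseSpace n)) (x : PhaseSpace n) :
    Convex ℝ (normalCone K x) :=
  (normalPointedCone K x).convex

theorem isClosed_normalCone_graph (K : Set (PhaseSpace n)) :
    IsClosed {z : PhaseSpace n × PhaseSpace n | z.2 ∈ normalCone K z.1} := by
  simp only [normalCone, mem_ofPred_eq]
  simp only [ofPred_forall]
  exact isClosed_iInter fun y => isClosed_iInter fun _ =>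
    isClosed_le continuous_const (by fun_prop)

theorem isIsotropic_span {s : Set (PhaseSpace n)} (h : ∀ u ∈ s, ∀ v ∈ s, omega u v = 0) :
    IsIsotropic (Submodule.span ℝ s) := by
  intro u hu v hv
  rw [omega_eq_inner]
  induction hu, hv using Submodule.span_induction₂ with
  | mem_mem u v hu hv => rw [← omega_eq_inner, h u hu v hv]
  | zero_left v _ => rw [map_zero, inner_zero_left]
  | zero_right u _ => rw [inner_zero_right]
  | add_left u u' v _ _ _ hu hu' => rw [map_add, inner_add_left, hu, hu', add_zero]
  | add_right u v v' _ _ _ hv hv' => rw [inner_add_right, hv, hv', add_zero]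
  | smul_left c u v _ _ h => rw [map_smul, real_inner_smul_left, h, mul_zero]
  | smul_right c u v _ _ h => rw [inner_smul_right, h, mul_zero]

theorem isExtremeFace_minimalFace (hv : v ∈ normalCone K x) :
    IsExtremeFace (normalCone K x) (minimalFace (normalCone K x) v) :=
  ⟨⟨_, rfl⟩, isExtreme_minimalFace (C := normalPointedCone K x) hv⟩

theorem isExtremeRay_minimalFace_iff (hv : v ∈ normalCone K x) :
    IsExtremeRay (normalCone K x) (minimalFace (normalCone K x) v) ↔
      Module.finrank ℝ (Submodule.span ℝ (faceDirections (normalCone K x) v)) = 1 := by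
  rw [← coe_normalPointedCone, ← span_minimalFace (C := normalPointedCone K x) hv]
  exact and_iff_right (isExtremeFace_minimalFace hv)

theorem exists_ne_zero_mem_normalCone (hconv : Convex ℝ K) (hint : (interior K).Nonempty)
    (hx : x ∈ frontier K) : ∃ u ∈ normalCone K x, u ≠ 0 := by
  obtain ⟨f, hf0, hf⟩ := geometric_hahn_banach_of_nonempty_interior_point hconv
    (x := x) (fun h => hx.2 h) hint
  refine ⟨(InnerProductSpace.toDual ℝ (PhaseSpace n)).symm f, fun y hy => ?_, by simpa using hf0⟩
  rw [InnerProductSpace.toDual_symm_apply, map_sub, sub_nonneg]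
  exact hf y hy

theorem exists_isExtremeRay (hconv : Convex ℝ K) (hint : (interior K).Nonempty)
    (hx : x ∈ frontier K) : ∃ R, IsExtremeRay (normalCone K x) R ∧ 0 ∈ R := by
  obtain ⟨u, hu, hu0⟩ := exists_ne_zero_mem_normalCone hconv hint hx
  obtain ⟨a, ha⟩ := hint
  obtain ⟨r, hr, hball⟩ := Metric.nhds_basis_closedBall.mem_iff.1 (mem_interior_iff_mem_nhds.1 ha)
  have hlower : ∀ w ∈ normalPointedCone K x, r * ‖w‖ ≤ innerSL ℝ (x - a) w := by
    intro w hw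
    rw [innerSL_apply_apply, real_inner_comm]
    refine mul_norm_le_of_forall_inner_le hr.le le_rfl fun y hy => ?_
    have hay := hw (a + y) (hball (by simpa using hy))
    rw [← sub_sub, inner_sub_right] at hay
    linarith
  have hclosed : IsClosed (normalPointedCone K x : Set (PhaseSpace n)) :=
    (isClosed_normalCone_graph K).preimage (Continuous.prodMk_right x)
  obtain ⟨e, he, he0, hray⟩ :=
    exists_faceDirections_subset_span_singleton hclosed hu hu0 hr hlower
  refine ⟨_, (isExtremeRay_minimalFace_iff he).2 ?_,
    zero_mem_minimalFace (normalPointedCone K x) e⟩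
  exact (congrArg (fun W : Submodule ℝ (PhaseSpace n) => Module.finrank ℝ W)
    (span_faceDirections_eq_span_singleton he hray)).trans (finrank_span_singleton he0)

end normalCone

/-! ### The symplectic form on face directions -/

section linearAlgebra

variable {ι : Type*} [Fintype ι]

theorem sub_le_sum_sum_mul_of_le_diag {A : ι → ι → ℝ} {q η : ℝ} (hη : 0 ≤ η)
    (hdiag : ∀ i, q ≤ A i i) (hoff : ∀ i j, i ≠ j → |A i j| ≤ η) (c : ι → ℝ) :
    q * ∑ i, c i ^ 2 - η * (∑ i, |c i|) ^ 2 ≤ ∑ i, ∑ j, c i * (c j * A i j) := by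
  classical
  have hterm : ∀ i j, (if i = j then q * c i ^ 2 else 0) - η * (|c i| * |c j|) ≤
      c i * (c j * A i j) := by
    intro i j
    split_ifs with hij
    · subst hij
      have hsq := mul_le_mul_of_nonneg_left (hdiag i) (sq_nonneg (c i))
      have hpos : 0 ≤ η * (|c i| * |c i|) := by positivity
      linarith
    · have habs : |c i * (c j * A i j)| ≤ η * (|c i| * |c j|) := by
        rw [← mul_assoc, abs_mul, abs_mul, mul_comm]
        exact mul_le_mul_of_nonneg_right (hoff i j hij) (by positivity)
      linarith [(abs_le.1 habs).1]
  refine le_trans (le_of_eq ?_)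
    (Finset.sum_le_sum fun i _ => Finset.sum_le_sum fun j _ => hterm i j)
  simp only [Finset.sum_sub_distrib, Finset.sum_ite_eq, Finset.mem_univ, if_true]
  rw [sq (∑ i, |c i|), Finset.sum_mul_sum]
  simp only [Finset.mul_sum]

theorem sum_sum_mul_pos_of_diagonally_dominant {A : ι → ι → ℝ} {c : ι → ℝ} {q η : ℝ}
    (hη : 0 ≤ η) (hdiag : ∀ i, q ≤ A i i) (hoff : ∀ i j, i ≠ j → |A i j| ≤ η)
    (hq : Fintype.card ι * η < q) (hc : c ≠ 0) :
    0 < ∑ i, ∑ j, c i * (c j * A i j) := by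
  have hCS : (∑ i, |c i|) ^ 2 ≤ Fintype.card ι * ∑ i, c i ^ 2 := by
    simpa using sq_sum_le_card_mul_sum_sq (s := Finset.univ) (f := fun i => |c i|)
  have hpos : 0 < ∑ i, c i ^ 2 := by
    obtain ⟨i, hi⟩ := Function.ne_iff.1 hc
    exact Finset.sum_pos' (fun _ _ => sq_nonneg _) ⟨i, Finset.mem_univ i, sq_pos_of_ne_zero hi⟩
  calc 0 < (q - Fintype.card ι * η) * ∑ i, c i ^ 2 := mul_pos (sub_pos.2 hq) hpos
    _ = q * ∑ i, c i ^ 2 - η * (Fintype.card ι * ∑ i, c i ^ 2) := by ring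
    _ ≤ q * ∑ i, c i ^ 2 - η * (∑ i, |c i|) ^ 2 := by gcongr
    _ ≤ _ := sub_le_sum_sum_mul_of_le_diag hη hdiag hoff c

theorem exists_ne_zero_sum_abs_le_sum_smul_eq_zero {W : Type*} [AddCommGroup W] [Module ℝ W]
    [FiniteDimensional ℝ W] (hι : Module.finrank ℝ W < Fintype.card ι) (x : ι → W) {ε : ℝ}
    (hε : 0 < ε) : ∃ c : ι → ℝ, c ≠ 0 ∧ ∑ i, |c i| ≤ ε ∧ ∑ i, c i • x i = 0 := by
  have hdep : ¬LinearIndependent ℝ x := fun h => hι.not_ge h.fintype_card_le_finrank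
  obtain ⟨c, hc, i, hi⟩ := Fintype.not_linearIndependent_iff.1 hdep
  set S := ∑ i, |c i|
  have hS : 0 < S :=
    Finset.sum_pos' (fun _ _ => abs_nonneg _) ⟨i, Finset.mem_univ i, abs_pos.2 hi⟩
  refine ⟨(ε / S) • c, smul_ne_zero (by positivity) (Function.ne_iff.2 ⟨i, hi⟩), ?_, ?_⟩
  · simp only [Pi.smul_apply, smul_eq_mul, abs_mul, ← Finset.mul_sum]
    rw [abs_of_pos (by positivity), div_mul_cancel₀ ε hS.ne']
  · simp only [Pi.smul_apply, smul_assoc, ← Finset.smul_sum, hc, smul_zero]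

end linearAlgebra

section sums

variable {ι : Type*} [Fintype ι] {T : ℝ}

theorem primitive_sum_smul {F : Type*} [NormedAddCommGroup F] [NormedSpace ℝ F] {d : ι → ℝ → F}
    (hd : ∀ i, Integrable (d i)) (c : ι → ℝ) (t : ℝ) :
    primitive (fun t => ∑ i, c i • d i t) t = ∑ i, c i • primitive (d i) t := by
  rw [primitive, intervalIntegral.integral_finsetSum fun i _ =>
    ((hd i).fun_smul (c i)).intervalIntegrable]
  exact Finset.sum_congr rfl fun i _ => primitive_smul _ _ _

theorem integrable_sum_smul {F : Type*} [NormedAddCommGroup F] [NormedSpace ℝ F] {d : ι → ℝ → F}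
    (hd : ∀ i, Integrable (d i)) (c : ι → ℝ) : Integrable fun t => ∑ i, c i • d i t :=
  integrable_finsetSum _ fun i _ => (hd i).fun_smul (c i)

variable {d : ι → ℝ → PhaseSpace n} {w : ℝ → PhaseSpace n}

theorem areaForm_sum_smul_left (hd : ∀ i, Integrable (d i)) (hw : Integrable w) (c : ι → ℝ) :
    areaForm T (fun t => ∑ i, c i • d i t) w = ∑ i, c i * areaForm T (d i) w := by
  simp only [areaForm, primitive_sum_smul hd, map_sum, map_smul, sum_inner,
    real_inner_smul_left]
  rw [intervalIntegral.integral_finsetSum fun i _ =>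
    (intervalIntegrable_areaForm (hd i) hw _ _).const_mul (c i)]
  exact Finset.sum_congr rfl fun i _ => intervalIntegral.integral_const_mul _ _

theorem areaForm_sum_smul_right (hd : ∀ i, Integrable (d i)) (hw : Integrable w) (c : ι → ℝ) :
    areaForm T w (fun t => ∑ i, c i • d i t) = ∑ i, c i * areaForm T w (d i) := by
  simp only [areaForm, inner_sum, inner_smul_right]
  rw [intervalIntegral.integral_finsetSum fun i _ =>
    (intervalIntegrable_areaForm hw (hd i) _ _).const_mul (c i)]
  exact Finset.sum_congr rfl fun i _ => intervalIntegral.integral_const_mul _ _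

theorem areaForm_sum_smul_sum_smul (hd : ∀ i, Integrable (d i)) (c : ι → ℝ) :
    areaForm T (fun t => ∑ i, c i • d i t) (fun t => ∑ i, c i • d i t) =
      ∑ i, ∑ j, c i * (c j * areaForm T (d i) (d j)) := by
  rw [areaForm_sum_smul_left hd (integrable_sum_smul hd c)]
  simp only [areaForm_sum_smul_right hd (hd _), Finset.mul_sum]

end sums

section smallLoops

variable {T C : ℝ} {p q : ℝ → PhaseSpace n}

theorem eventually_loopVelocity_estimates (hp : LocallyIntegrable p) (hq : LocallyIntegrable q)
    (hpC : ∀ t, ‖p t‖ ≤ C) (hqC : ∀ t, ‖q t‖ ≤ C) {τ : ℝ} (hτ : τ ∈ Ico 0 T)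
    (hpτ : IsRightLebesguePoint p τ) (hqτ : IsRightLebesguePoint q τ) {κ : ℝ} (hκ : 0 < κ) :
    ∀ᶠ h in 𝓝[>] 0, ‖primitive (loopVelocity τ h p q) T‖ ≤ κ * h ∧
      |areaForm T (loopVelocity τ h p q) (loopVelocity τ h p q) + h ^ 2 / 15 * omega (p τ) (q τ)| ≤
        κ * h ^ 2 := by
  have hC : 0 ≤ C := (norm_nonneg _).trans (hpC 0)
  set κ' := κ / (4 * C + 1)
  have hκ'pos : 0 < κ' := by positivity
  have hκ'eq : κ' * (4 * C + 1) = κ := div_mul_cancel₀ κ (by positivity)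
  filter_upwards [hpτ _ (half_pos hκ'pos), hqτ _ (half_pos hκ'pos), self_mem_nhdsWithin,
    nhdsWithin_le_nhds (eventually_le_nhds (sub_pos.2 hτ.2))] with h hph hqh (hh : 0 < h) hhT
  have hτT : τ + h ≤ T := by linarith
  have hint : ∀ {x : ℝ → PhaseSpace n}, LocallyIntegrable x →
      IntervalIntegrable (fun t => ‖x t - x τ‖) volume τ (τ + h) := fun hx =>
    (intervalIntegrable_iff_integrableOn_Icc_of_le (by linarith)).2
      ((hx.sub (locallyIntegrable_const _)).integrableOn_isCompact isCompact_Icc).norm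
  have hosc : ∫ t in τ..(τ + h), (‖p t - p τ‖ + ‖q t - q τ‖) ≤ κ' * h := by
    rw [intervalIntegral.integral_add (hint hp) (hint hq)]
    linarith
  constructor
  · refine (norm_primitive_loopVelocity_le hh hτ.1 hτT hp hq).trans (hosc.trans ?_)
    exact mul_le_mul_of_nonneg_right (div_le_self hκ.le (by linarith)) hh.le
  · refine (abs_areaForm_loopVelocity_add_le hh hτ.1 hτT hp hq hpC hqC).trans ?_
    calc _ ≤ κ' * h * (4 * C * h) := mul_le_mul_of_nonneg_right hosc (by positivity)
      _ = (κ - κ') * h ^ 2 := by rw [← hκ'eq]; ring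
      _ ≤ κ * h ^ 2 := mul_le_mul_of_nonneg_right (sub_le_self κ hκ'pos.le) (sq_nonneg h)

theorem eventually_forall_areaForm_sum_loopVelocity_pos (hp : LocallyIntegrable p)
    (hq : LocallyIntegrable q) (hpC : ∀ t, ‖p t‖ ≤ C) (hqC : ∀ t, ‖q t‖ ≤ C) {ι : Type*}
    [Fintype ι] {τ : ι → ℝ} (hinj : Function.Injective τ) (hτ : ∀ i, τ i ∈ Ico 0 T)
    (hpτ : ∀ i, IsRightLebesguePoint p (τ i)) (hqτ : ∀ i, IsRightLebesguePoint q (τ i))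
    (hω : ∀ i, omega (p (τ i)) (q (τ i)) < 0) :
    ∀ᶠ h in 𝓝[>] 0, ∀ c : ι → ℝ, c ≠ 0 →
      0 < areaForm T (fun t => ∑ i, c i • loopVelocity (τ i) h p q t)
        (fun t => ∑ i, c i • loopVelocity (τ i) h p q t) := by
  classical
  -- Up to the factor `h ^ 2`, the Gram matrix of `areaForm` on the loops has diagonal entries
  -- close to `-ω / 15 > 0` and off-diagonal entries of order `κ ^ 2`.
  have hlim : ∀ i, ∀ᶠ κ in 𝓝[>] (0 : ℝ),
      Fintype.card ι * κ ^ 2 + κ < -omega (p (τ i)) (q (τ i)) / 15 := fun i => by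
    have hcont : Continuous fun κ : ℝ => Fintype.card ι * κ ^ 2 + κ := by fun_prop
    refine nhdsWithin_le_nhds (hcont.continuousAt.eventually_lt continuousAt_const ?_)
    have := hω i
    norm_num
    linarith
  obtain ⟨κ, hκ, hκpos : 0 < κ⟩ := ((eventually_all.2 hlim).and self_mem_nhdsWithin).exists
  have hsep : ∀ i j, ∀ᶠ h in 𝓝[>] (0 : ℝ), i ≠ j → h ≤ |τ i - τ j| := fun i j => by
    by_cases hij : i = j
    · exact Eventually.of_forall fun _ hne => absurd hij hne
    · filter_upwards [nhdsWithin_le_nhds (eventually_le_nhds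
        (abs_pos.2 (sub_ne_zero.2 (hinj.ne hij))))] with h hh _ using hh
  filter_upwards [eventually_all.2 fun i => eventually_loopVelocity_estimates hp hq hpC hqC (hτ i)
    (hpτ i) (hqτ i) hκpos, eventually_all.2 fun i => eventually_all.2 (hsep i),
    self_mem_nhdsWithin] with h hest hsep (hh : 0 < h) c hc
  have : Nonempty ι := (Function.ne_iff.1 hc).nonempty
  have hint := fun i => integrable_loopVelocity (τ := τ i) hh hp hq
  rw [areaForm_sum_smul_sum_smul hint]
  have hdiag : ∀ i, (Fintype.card ι * κ ^ 2) * h ^ 2 < areaForm T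
      (loopVelocity (τ i) h p q) (loopVelocity (τ i) h p q) := fun i => by
    have := mul_lt_mul_of_pos_right (hκ i) (pow_pos hh 2)
    linarith [(abs_le.1 (hest i).2).1]
  obtain ⟨i₁, hmin⟩ := Finite.exists_min fun i =>
    areaForm T (loopVelocity (τ i) h p q) (loopVelocity (τ i) h p q)
  refine sum_sum_mul_pos_of_diagonally_dominant (sq_nonneg (κ * h)) hmin (fun i j hij =>
    abs_areaForm_loopVelocity_le ((hτ i).1.trans (hτ i).2.le) (hint i) (hint j) (hsep i j hij)
      (hest i).1 (hest j).1) ?_ hc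
  rw [mul_pow, ← mul_assoc]
  exact hdiag i₁

theorem exists_sum_loopVelocity_eq_smul_add_smul {ι : Type*} [Fintype ι] {h : ℝ} (hh : 0 < h)
    (τ : ι → ℝ) {c : ι → ℝ} (hc : ∑ i, |c i| ≤ 1 / 2) (t : ℝ) :
    ∃ a b : ℝ, |a| ≤ 1 / 2 ∧ |b| ≤ 1 / 2 ∧
      ∑ i, c i • loopVelocity (τ i) h p q t = a • p t + b • q t := by
  have hbound : ∀ f : ι → ℝ → ℝ, (∀ i, ∀ t ∈ Icc (τ i) (τ i + h), |f i t| ≤ 1) →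
      |∑ i, c i * (Ioc (τ i) (τ i + h)).indicator (f i) t| ≤ 1 / 2 := by
    intro f hf
    refine (Finset.abs_sum_le_sum_abs _ _).trans (le_trans (Finset.sum_le_sum fun i _ => ?_) hc)
    rw [abs_mul]
    refine mul_le_of_le_one_right (abs_nonneg _) ?_
    by_cases ht : t ∈ Ioc (τ i) (τ i + h)
    · rw [indicator_of_mem ht]
      exact hf i t (Ioc_subset_Icc_self ht)
    · rw [indicator_of_notMem ht, abs_zero]
      exact zero_le_one
  refine ⟨_, _, hbound (fun i => evenSpeed (τ i) h) fun i t => abs_evenSpeed_le hh,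
    hbound (fun i => oddSpeed (τ i) h) fun i t => abs_oddSpeed_le hh, ?_⟩
  simp only [Finset.sum_smul, ← Finset.sum_add_distrib]
  refine Finset.sum_congr rfl fun i _ => ?_
  by_cases ht : t ∈ Ioc (τ i) (τ i + h)
  · simp only [loopVelocity, indicator_of_mem ht, smul_add, smul_smul]
  · simp only [loopVelocity, indicator_of_notMem ht, smul_zero, mul_zero, zero_smul, add_zero]

end smallLoops

section minimizing

variable {K : Set (PhaseSpace n)} {T C : ℝ} {γ p q : ℝ → PhaseSpace n}

namespace IsActionMinimizing

theorem areaForm_sum_loopVelocity_nonpos (hγ : IsActionMinimizing K T γ)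
    (hconv : Convex ℝ K) (hcomp : IsCompact K) (hK : K ∈ 𝓝 0)
    (hp : LocallyIntegrable p) (hq : LocallyIntegrable q)
    (hpC : ∀ t, ‖p t‖ ≤ C) (hqC : ∀ t, ‖q t‖ ≤ C)
    (hpN : ∀ᵐ t, t ∈ Icc 0 T → p t ∈ faceDirections (normalCone K (γ t)) (normalVelocity T γ t))
    (hqN : ∀ᵐ t, t ∈ Icc 0 T → q t ∈ faceDirections (normalCone K (γ t)) (normalVelocity T γ t))
    {ι : Type*} [Fintype ι] {τ : ι → ℝ} {h : ℝ} (hh : 0 < h) (hτ0 : ∀ i, 0 ≤ τ i)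
    (hτT : ∀ i, τ i + h ≤ T) {c : ι → ℝ} (hc : ∑ i, |c i| ≤ 1 / 2)
    (hcT : ∑ i, c i • primitive (loopVelocity (τ i) h p q) T = 0)
    (hcγ : ∑ i, c i * ∫ t in (0 : ℝ)..T, inner ℝ (γ t) (loopVelocity (τ i) h p q t) = 0) :
    areaForm T (fun t => ∑ i, c i • loopVelocity (τ i) h p q t)
      (fun t => ∑ i, c i • loopVelocity (τ i) h p q t) ≤ 0 := by
  have hint := fun i => integrable_loopVelocity (τ := τ i) hh hp hq
  have hcomb := exists_sum_loopVelocity_eq_smul_add_smul (p := p) (q := q) hh τ hc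
  refine hγ.areaForm_nonpos hconv hcomp hK ?_ (fun t ht => ?_) ?_ ?_ ?_
  · refine MemLp.of_bound (C := C) (integrable_sum_smul hint c).1.restrict (ae_of_all _ fun t => ?_)
    obtain ⟨a, b, ha, hb, hab⟩ := hcomb t
    rw [hab]
    refine (norm_add_le _ _).trans ?_
    rw [norm_smul, norm_smul, Real.norm_eq_abs, Real.norm_eq_abs]
    linarith [mul_le_mul ha (hpC t) (norm_nonneg _) (by norm_num),
      mul_le_mul hb (hqC t) (norm_nonneg _) (by norm_num)]
  · refine Finset.sum_eq_zero fun i _ => ?_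
    rw [loopVelocity, indicator_of_notMem, smul_zero]
    exact fun hti => ht ⟨(hτ0 i).trans hti.1.le, hti.2.trans (hτT i)⟩
  · filter_upwards [hpN, hqN] with t hpt hqt ht
    obtain ⟨a, b, ha, hb, hab⟩ := hcomb t
    rw [hab]
    exact add_smul_add_smul_mem (convex_normalCone K (γ t)) (hpt ht) (hqt ht) ha hb
  · rw [primitive_sum_smul hint, hcT]
  · simp only [inner_sum, inner_smul_right]
    rw [intervalIntegral.integral_finsetSum fun i _ =>
      (hγ.1.intervalIntegrable_inner (hint i)).const_mul (c i)]
    simpa only [intervalIntegral.integral_const_mul] using hcγ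

theorem ae_omega_nonneg (hγ : IsActionMinimizing K T γ) (hconv : Convex ℝ K)
    (hcomp : IsCompact K) (hK : K ∈ 𝓝 0) (hp : LocallyIntegrable p) (hq : LocallyIntegrable q)
    (hpC : ∀ t, ‖p t‖ ≤ C) (hqC : ∀ t, ‖q t‖ ≤ C)
    (hpN : ∀ᵐ t, t ∈ Icc 0 T → p t ∈ faceDirections (normalCone K (γ t)) (normalVelocity T γ t))
    (hqN : ∀ᵐ t, t ∈ Icc 0 T → q t ∈ faceDirections (normalCone K (γ t)) (normalVelocity T γ t)) :
    ∀ᵐ t, t ∈ Icc 0 T → 0 ≤ omega (p t) (q t) := by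
  set Z : Set ℝ := {t | t ∈ Ico 0 T ∧ omega (p t) (q t) < 0 ∧ IsRightLebesguePoint p t ∧
    IsRightLebesguePoint q t}
  suffices hfin : Z.Finite by
    filter_upwards [hfin.countable.ae_notMem volume, ae_isRightLebesguePoint hp,
      ae_isRightLebesguePoint hq, Measure.ae_ne volume T] with t htZ hpt hqt htT ht
    by_contra! hlt
    exact htZ ⟨⟨ht.1, ht.2.lt_of_ne htT⟩, hlt, hpt, hqt⟩
  by_contra hZ
  -- The variation must close up and be orthogonal to `γ`: these are `2 * n + 1` equations.
  obtain ⟨s, hsZ, hcard⟩ := Set.Infinite.exists_subset_card_eq hZ (2 * n + 2)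
  have hsZ' : ∀ i : s, (i : ℝ) ∈ Z := fun i => hsZ i.2
  have hfit : ∀ i : s, ∀ᶠ h in 𝓝[>] (0 : ℝ), (i : ℝ) + h ≤ T := fun i => by
    filter_upwards [nhdsWithin_le_nhds (eventually_le_nhds (sub_pos.2 (hsZ' i).1.2))] with h hle
    linarith
  obtain ⟨h, hpos, hτT, hh : 0 < h⟩ := ((eventually_forall_areaForm_sum_loopVelocity_pos hp hq hpC
    hqC Subtype.val_injective (fun i => (hsZ' i).1) (fun i => (hsZ' i).2.2.1)
    (fun i => (hsZ' i).2.2.2) (fun i => (hsZ' i).2.1)).and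
      ((eventually_all.2 hfit).and self_mem_nhdsWithin)).exists
  have hdim : Module.finrank ℝ (PhaseSpace n × ℝ) < Fintype.card s := by
    rw [Module.finrank_prod, finrank_euclideanSpace, Fintype.card_sum, Fintype.card_fin,
      Module.finrank_self, Fintype.card_coe, hcard]
    omega
  obtain ⟨c, hc, hcabs, hcsum⟩ := exists_ne_zero_sum_abs_le_sum_smul_eq_zero hdim
    (fun i : s => (primitive (loopVelocity (i : ℝ) h p q) T,
      ∫ t in (0 : ℝ)..T, inner ℝ (γ t) (loopVelocity (i : ℝ) h p q t))) one_half_pos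
  have hcT := congrArg Prod.fst hcsum
  have hcγ := congrArg Prod.snd hcsum
  rw [Prod.fst_sum] at hcT
  rw [Prod.snd_sum] at hcγ
  exact (hpos c hc).not_ge (hγ.areaForm_sum_loopVelocity_nonpos hconv hcomp hK hp hq hpC hqC hpN
    hqN hh (fun i => (hsZ' i).1.1) hτT hcabs hcT hcγ)

end IsActionMinimizing

end minimizing

/-! ### Measurable selections -/

section selection

theorem exists_infEDist_eq_edist_of_isClosed {F : Type*} [PseudoMetricSpace F] [ProperSpace F]
    {s : Set F} (hs : IsClosed s) (hne : s.Nonempty) (a : F) :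
    ∃ w ∈ s, Metric.infEDist a s = edist a w := by
  obtain ⟨w, hw, hdist⟩ := hs.exists_infDist_eq_dist hne a
  refine ⟨w, hw, ?_⟩
  rw [edist_dist, ← hdist, Metric.infDist, ENNReal.ofReal_toReal (Metric.infEDist_ne_top hne)]

variable {Y F : Type*} [TopologicalSpace Y] {Γ : Set (Y × F)}

theorem isClosed_setOf_exists_mem [TopologicalSpace F] (hΓ : IsClosed Γ) {B : Set F}
    (hB : IsCompact B) : IsClosed {y | ∃ w ∈ B, (y, w) ∈ Γ} := by
  have : CompactSpace B := isCompact_iff_compactSpace.1 hB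
  have hpre : IsClosed ((fun z : Y × B => (z.1, (z.2 : F))) ⁻¹' Γ) := hΓ.preimage (by fun_prop)
  convert! isClosedMap_fst_of_compactSpace _ hpre using 1
  ext y
  exact ⟨fun ⟨w, hw, hy⟩ => ⟨(y, ⟨w, hw⟩), hy, rfl⟩, fun ⟨z, hz, hy⟩ => ⟨z.2, z.2.2, hy ▸ hz⟩⟩

variable [MeasurableSpace Y] [OpensMeasurableSpace Y]

theorem measurable_infEDist_section [PseudoMetricSpace F] [ProperSpace F] (hΓ : IsClosed Γ)
    (a : F) : Measurable fun y => Metric.infEDist a {w | (y, w) ∈ Γ} := by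
  refine measurable_of_Iic fun R => ?_
  rcases eq_or_ne R ⊤ with rfl | hR
  · simp only [Iic_top, preimage_univ, MeasurableSet.univ]
  convert! (isClosed_setOf_exists_mem hΓ (isCompact_closedBall a R.toReal)).measurableSet using 1
  ext y
  have hmem : ∀ w, w ∈ Metric.closedBall a R.toReal ↔ edist a w ≤ R := fun w => by
    rw [Metric.mem_closedBall, dist_comm, edist_dist, ENNReal.ofReal_le_iff_le_toReal hR]
  simp only [mem_preimage, mem_Iic, mem_ofPred_eq, hmem]
  constructor
  · intro hle
    have hne : {w | (y, w) ∈ Γ}.Nonempty := by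
      by_contra hempty
      rw [not_nonempty_iff_eq_empty.1 hempty, Metric.infEDist_empty] at hle
      exact hR (top_le_iff.1 hle)
    obtain ⟨w, hw, heq⟩ := exists_infEDist_eq_edist_of_isClosed
      (hΓ.preimage (Continuous.prodMk_right y)) hne a
    exact ⟨w, heq ▸ hle, hw⟩
  · rintro ⟨w, hle, hw⟩
    exact (Metric.infEDist_le_edist_of_mem (s := {w | (y, w) ∈ Γ}) hw).trans hle

theorem eq_of_forall_norm_sub_le [NormedAddCommGroup F] [InnerProductSpace ℝ F] {s : Set F}
    (hs : Convex ℝ s) {a x y : F} (hx : x ∈ s) (hy : y ∈ s)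
    (hmin : ∀ w ∈ s, ‖a - x‖ ≤ ‖a - w‖) (hle : ‖a - y‖ ≤ ‖a - x‖) : y = x := by
  have hmid := hmin _ (hs.midpoint_mem hx hy)
  have hdouble : ‖(a - x) + (a - y)‖ = 2 * ‖a - midpoint ℝ x y‖ := by
    rw [← Real.norm_two, ← norm_smul, midpoint_eq_smul_add, invOf_eq_inv]
    congr 1
    module
  have hpar := parallelogram_law_with_norm ℝ (a - x) (a - y)
  rw [sub_sub_sub_cancel_left, hdouble] at hpar
  have hzero : ‖y - x‖ * ‖y - x‖ ≤ 0 := by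
    linarith [mul_self_le_mul_self (norm_nonneg _) hmid, mul_self_le_mul_self (norm_nonneg _) hle]
  rwa [← sub_eq_zero, ← norm_eq_zero, ← mul_self_eq_zero,
    ← (mul_self_nonneg ‖y - x‖).ge_iff_eq']

variable [NormedAddCommGroup F] [InnerProductSpace ℝ F] [ProperSpace F] [MeasurableSpace F]
  [BorelSpace F]

theorem exists_measurable_nearest (hΓ : IsClosed Γ) (hconv : ∀ y, Convex ℝ {w | (y, w) ∈ Γ})
    (hne : ∀ y, ∃ w, (y, w) ∈ Γ) (a : F) :
    ∃ p : Y → F, Measurable p ∧ (∀ y, (y, p y) ∈ Γ) ∧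
      ∀ y w, (y, w) ∈ Γ → ‖a - p y‖ ≤ ‖a - w‖ := by
  have hex : ∀ y, ∃ x, (y, x) ∈ Γ ∧ Metric.infEDist a {w | (y, w) ∈ Γ} = edist a x := fun y =>
    exists_infEDist_eq_edist_of_isClosed (hΓ.preimage (Continuous.prodMk_right y)) (hne y) a
  choose p hpΓ hp using hex
  have hmin : ∀ y w, (y, w) ∈ Γ → ‖a - p y‖ ≤ ‖a - w‖ := fun y w hw => by
    have hle := Metric.infEDist_le_edist_of_mem (x := a) (s := {w | (y, w) ∈ Γ}) hw
    rwa [hp, edist_dist, edist_dist, ENNReal.ofReal_le_ofReal_iff dist_nonneg, dist_eq_norm,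
      dist_eq_norm] at hle
  refine ⟨p, measurable_of_isClosed fun C hC => ?_, hpΓ, hmin⟩
  -- By uniqueness, `p y ∈ C` if and only if `C` contains a nearest point of the section.
  have hΓC : IsClosed (Γ ∩ {z | z.2 ∈ C}) := hΓ.inter (hC.preimage continuous_snd)
  convert! measurableSet_le (measurable_infEDist_section hΓC a)
    (measurable_infEDist_section hΓ a) using 1
  ext y
  rw [mem_preimage, mem_ofPred_eq, hp]
  constructor
  · exact fun hy => Metric.infEDist_le_edist_of_mem (s := {w | (y, w) ∈ Γ ∩ {z | z.2 ∈ C}})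
      ⟨hpΓ y, hy⟩
  · intro hle
    have hneC : {w | (y, w) ∈ Γ ∩ {z | z.2 ∈ C}}.Nonempty := by
      by_contra hempty
      rw [not_nonempty_iff_eq_empty.1 hempty, Metric.infEDist_empty] at hle
      exact edist_ne_top _ _ (top_le_iff.1 hle)
    obtain ⟨w, ⟨hwΓ, hwC⟩, heq⟩ := exists_infEDist_eq_edist_of_isClosed
      (s := {w | (y, w) ∈ Γ ∩ {z | z.2 ∈ C}}) (hΓC.preimage (Continuous.prodMk_right y)) hneC a
    rw [heq, edist_dist, edist_dist, ENNReal.ofReal_le_ofReal_iff dist_nonneg, dist_eq_norm,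
      dist_eq_norm] at hle
    rwa [mem_ofPred_eq, eq_of_forall_norm_sub_le (hconv y) (hpΓ y) hwΓ (hmin y) hle] at hwC

theorem exists_dense_measurable_selections (hΓ : IsClosed Γ)
    (hconv : ∀ y, Convex ℝ {w | (y, w) ∈ Γ}) (hne : ∀ y, ∃ w, (y, w) ∈ Γ) :
    ∃ p : ℕ → Y → F, (∀ i, Measurable (p i)) ∧ (∀ i y, (y, p i y) ∈ Γ) ∧
      (∀ y w, (y, w) ∈ Γ → w ∈ closure (range fun i => p i y)) ∧
      ∀ i, ∃ C, ∀ y w, (y, w) ∈ Γ → ‖p i y‖ ≤ C + ‖w‖ := by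
  choose p hpm hpΓ hp using exists_measurable_nearest hΓ hconv hne
  set a := TopologicalSpace.denseSeq F
  refine ⟨fun i => p (a i), fun i => hpm _, fun i => hpΓ _, fun y w hw => ?_, fun i =>
    ⟨2 * ‖a i‖, fun y w hw => ?_⟩⟩
  · refine Metric.mem_closure_range_iff.2 fun ε hε => ?_
    obtain ⟨i, hi⟩ := (TopologicalSpace.denseRange_denseSeq F).exists_dist_lt w (half_pos hε)
    refine ⟨i, ?_⟩
    have hnear := hp (a i) y w hw
    rw [← dist_eq_norm, ← dist_eq_norm, dist_comm _ w] at hnear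
    linarith [dist_triangle w (a i) (p (a i) y)]
  · have hnorm := norm_sub_norm_le (p (a i) y) (a i)
    rw [norm_sub_rev] at hnorm
    linarith [hp (a i) y w hw, norm_sub_le (a i) w]

end selection

section denseSelections

theorem isClosed_faceDirections_normalCone_graph (K : Set (PhaseSpace n)) :
    IsClosed {z : (PhaseSpace n × PhaseSpace n) × PhaseSpace n |
      z.2 ∈ faceDirections (normalCone K z.1.1) z.1.2} :=
  ((isClosed_normalCone_graph K).preimage
    (f := fun z : (PhaseSpace n × PhaseSpace n) × PhaseSpace n => (z.1.1, z.1.2 + z.2))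
    (by fun_prop)).inter
      ((isClosed_normalCone_graph K).preimage
        (f := fun z : (PhaseSpace n × PhaseSpace n) × PhaseSpace n => (z.1.1, z.1.2 - z.2))
        (by fun_prop))

theorem exists_dense_measurable_faceDirections {Ω : Type*} [MeasurableSpace Ω]
    {K : Set (PhaseSpace n)} {x v : Ω → PhaseSpace n} (hx : Measurable x) (hv : Measurable v)
    (hxv : ∀ t, v t ∈ normalCone K (x t)) :
    ∃ p : ℕ → Ω → PhaseSpace n, (∀ i, Measurable (p i)) ∧ (∀ i, ∃ C, ∀ t, ‖p i t‖ ≤ C) ∧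
      ∀ t, (∀ i, p i t ∈ faceDirections (normalCone K (x t)) (v t)) ∧
        faceDirections (normalCone K (x t)) (v t) ⊆ closure (range fun i => p i t) := by
  have hzero : ∀ z : {z : PhaseSpace n × PhaseSpace n // z.2 ∈ normalCone K z.1},
      (0 : PhaseSpace n) ∈ faceDirections (normalCone K z.1.1) z.1.2 :=
    fun z => zero_mem_faceDirections z.2
  have hclosed := (isClosed_faceDirections_normalCone_graph K).preimage
    (continuous_subtype_val.prodMap continuous_id :
      Continuous (Prod.map (Subtype.val (p := fun z => z.2 ∈ normalCone K z.1)) id))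
  obtain ⟨p, hpm, hp, hdense, hbound⟩ := exists_dense_measurable_selections hclosed
    (fun z => convex_faceDirections (convex_normalCone K z.1.1) z.1.2) fun z => ⟨0, hzero z⟩
  have hxv' : Measurable fun t =>
      (⟨(x t, v t), hxv t⟩ : {z : PhaseSpace n × PhaseSpace n // z.2 ∈ normalCone K z.1}) :=
    (hx.prodMk hv).subtype_mk
  refine ⟨fun i t => p i ⟨(x t, v t), hxv t⟩, fun i => (hpm i).comp hxv', fun i => ?_,
    fun t => ⟨fun i => hp i ⟨(x t, v t), hxv t⟩, fun w hw => hdense ⟨(x t, v t), hxv t⟩ w hw⟩⟩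
  obtain ⟨C, hC⟩ := hbound i
  refine ⟨C, fun t => ?_⟩
  simpa using hC ⟨(x t, v t), hxv t⟩ 0 (hzero ⟨(x t, v t), hxv t⟩)

theorem IsClosedCharacteristic.exists_dense_measurable_faceDirections {K : Set (PhaseSpace n)}
    {T : ℝ} {γ : ℝ → PhaseSpace n} (h : IsClosedCharacteristic K T γ) :
    ∃ p : ℕ → ℝ → PhaseSpace n, (∀ i, Measurable (p i)) ∧ (∀ i, ∃ C, ∀ t, ‖p i t‖ ≤ C) ∧
      ∀ᵐ t, t ∈ Icc 0 T →
        (∀ i, p i t ∈ faceDirections (normalCone K (γ t)) (normalVelocity T γ t)) ∧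
        faceDirections (normalCone K (γ t)) (normalVelocity T γ t) ⊆
          closure (range fun i => p i t) := by
  set β : ℝ → PhaseSpace n := IccExtend h.period_pos.le ((Icc 0 T).domRestrict γ)
  have hβ : Measurable β :=
    (continuousOn_iff_continuous_domRestrict.1 h.continuousOn).Icc_extend'.measurable
  have hβγ : ∀ t ∈ Icc 0 T, β t = γ t := fun t ht => IccExtend_of_mem _ _ ht
  have hv := measurable_normalVelocity T γ
  set A : Set ℝ := {t | normalVelocity T γ t ∈ normalCone K (β t)}
  have hA : MeasurableSet A :=
    (hβ.prodMk hv) (isClosed_normalCone_graph K).measurableSet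
  have hcone : ∀ t, A.indicator (normalVelocity T γ) t ∈ normalCone K (β t) := fun t => by
    by_cases ht : t ∈ A
    · rwa [indicator_of_mem ht]
    · rw [indicator_of_notMem ht]
      exact zero_mem (normalPointedCone K (β t))
  obtain ⟨p, hpm, hpC, hp⟩ :=
    PhaseSpace.exists_dense_measurable_faceDirections hβ (hv.indicator hA) hcone
  refine ⟨p, hpm, hpC, ?_⟩
  filter_upwards [h.normalVelocity_mem_normalCone] with t htN ht
  have htA : t ∈ A := by
    rw [← hβγ t ht] at htN
    exact htN ht
  simpa only [indicator_of_mem htA, hβγ t ht] using hp t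

end denseSelections

/-! ### Isotropy of the velocity faces -/

theorem omega_comm (u v : PhaseSpace n) : omega u v = -omega v u := by
  rw [omega_eq_inner, omega_eq_inner, inner_J_comm]

theorem continuous_omega : Continuous fun z : PhaseSpace n × PhaseSpace n => omega z.1 z.2 := by
  simp only [omega_eq_inner]
  exact (continuous_J.comp continuous_fst).inner continuous_snd

theorem omega_eq_zero_of_mem_closure {s : Set (PhaseSpace n)}
    (hs : ∀ u ∈ s, ∀ v ∈ s, 0 ≤ omega u v) {u v : PhaseSpace n} (hu : u ∈ closure s)
    (hv : v ∈ closure s) : omega u v = 0 := by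
  have hclosed : IsClosed {z : PhaseSpace n × PhaseSpace n | omega z.1 z.2 = 0} :=
    isClosed_eq continuous_omega continuous_const
  refine closure_minimal (s := s ×ˢ s) ?_ hclosed (a := (u, v)) ?_
  · rintro ⟨u, v⟩ ⟨hu, hv⟩
    have hneg := hs v hv u hu
    rw [omega_comm, neg_nonneg] at hneg
    exact hneg.antisymm (hs u hu v hv)
  · rw [closure_prod_eq]
    exact ⟨hu, hv⟩

theorem locallyIntegrable_of_norm_le {F : Type*} [NormedAddCommGroup F] {f : ℝ → F} {C : ℝ}
    (hf : AEStronglyMeasurable f) (hC : ∀ t, ‖f t‖ ≤ C) : LocallyIntegrable f :=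
  (locallyIntegrable_const C).mono hf (ae_of_all _ fun t => (hC t).trans (le_abs_self C))

section minimizing

variable {K : Set (PhaseSpace n)} {T : ℝ} {γ : ℝ → PhaseSpace n}

theorem IsActionMinimizing.ae_isIsotropic_of_mem_nhds (hγ : IsActionMinimizing K T γ)
    (hconv : Convex ℝ K) (hcomp : IsCompact K) (hK : K ∈ 𝓝 0) :
    ∀ᵐ t, t ∈ Icc 0 T → IsIsotropic
      (Submodule.span ℝ (faceDirections (normalCone K (γ t)) (normalVelocity T γ t))) := by
  obtain ⟨p, hpm, hpC, hp⟩ := hγ.1.exists_dense_measurable_faceDirections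
  have hloc : ∀ i, LocallyIntegrable (p i) := fun i =>
    (hpC i).elim fun C hC => locallyIntegrable_of_norm_le (hpm i).aestronglyMeasurable hC
  have hpN : ∀ i, ∀ᵐ t, t ∈ Icc 0 T →
      p i t ∈ faceDirections (normalCone K (γ t)) (normalVelocity T γ t) := fun i =>
    hp.mono fun t ht htT => (ht htT).1 i
  have hnonneg : ∀ᵐ t, ∀ i j, t ∈ Icc 0 T → 0 ≤ omega (p i t) (p j t) := by
    refine ae_all_iff.2 fun i => ae_all_iff.2 fun j => ?_
    obtain ⟨C, hC⟩ := hpC i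
    obtain ⟨C', hC'⟩ := hpC j
    exact hγ.ae_omega_nonneg hconv hcomp hK (hloc i) (hloc j)
      (fun t => (hC t).trans (le_max_left C C')) (fun t => (hC' t).trans (le_max_right C C'))
      (hpN i) (hpN j)
  filter_upwards [hnonneg, hp] with t ht hpt htT
  have hrange : ∀ u ∈ range fun i => p i t, ∀ v ∈ range fun i => p i t, 0 ≤ omega u v := by
    rintro _ ⟨i, rfl⟩ _ ⟨j, rfl⟩
    exact ht i j htT
  exact isIsotropic_span fun u hu v hv =>
    omega_eq_zero_of_mem_closure hrange ((hpt htT).2 hu) ((hpt htT).2 hv)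

theorem normalCone_preimage_add (K : Set (PhaseSpace n)) (a x : PhaseSpace n) :
    normalCone ((fun y => y + a) ⁻¹' K) (x - a) = normalCone K x := by
  ext v
  refine ⟨fun h y hy => ?_, fun h y hy => ?_⟩
  · rw [← sub_sub_sub_cancel_right x y a]
    exact h (y - a) (by rwa [mem_preimage, sub_add_cancel])
  · rw [sub_right_comm, sub_sub]
    exact h (y + a) hy

theorem deriv_translate (γ : ℝ → PhaseSpace n) (a : PhaseSpace n) :
    deriv (fun t => γ t - a) = deriv γ :=
  funext fun _ => deriv_sub_const a

theorem normalVelocity_translate (T : ℝ) (γ : ℝ → PhaseSpace n) (a : PhaseSpace n) :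
    normalVelocity T (fun t => γ t - a) = normalVelocity T γ := by
  rw [normalVelocity, normalVelocity, deriv_translate]

theorem IsClosedCharacteristic.translate (h : IsClosedCharacteristic K T γ) (a : PhaseSpace n) :
    IsClosedCharacteristic ((fun y => y + a) ⁻¹' K) T (fun t => γ t - a) where
  period_pos := h.period_pos
  absolutelyContinuous := absolutelyContinuousOnInterval_of_dist_le (C := 1)
    h.absolutelyContinuous fun s _ t _ => by rw [dist_sub_right, one_mul]
  deriv_memLp := by
    rw [deriv_translate]
    exact h.deriv_memLp
  closed := by rw [h.closed]
  mem_boundary t ht := by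
    change γ t - a ∈ frontier (Homeomorph.addRight a ⁻¹' K)
    rw [← Homeomorph.preimage_frontier]
    simpa only [mem_preimage, Homeomorph.coe_addRight, sub_add_cancel] using h.mem_boundary t ht
  velocity := by
    simp only [deriv_translate, normalCone_preimage_add]
    exact h.velocity
  nonconstant := by
    obtain ⟨t, ht, hne⟩ := h.nonconstant
    exact ⟨t, ht, fun heq => hne (sub_left_injective heq)⟩

theorem IsClosedCharacteristic.two_mul_action_eq_areaForm (h : IsClosedCharacteristic K T γ) :
    2 * action T γ = areaForm T (normalVelocity T γ) (normalVelocity T γ) := by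
  rw [h.two_mul_action,
    h.areaForm_normalVelocity h.integrable_normalVelocity h.primitive_normalVelocity]

theorem IsClosedCharacteristic.action_translate (h : IsClosedCharacteristic K T γ)
    (a : PhaseSpace n) : action T (fun t => γ t - a) = action T γ := by
  have htwo := (h.translate a).two_mul_action_eq_areaForm
  rw [normalVelocity_translate, ← h.two_mul_action_eq_areaForm] at htwo
  exact mul_left_cancel₀ two_ne_zero htwo

theorem IsActionMinimizing.translate (h : IsActionMinimizing K T γ) (a : PhaseSpace n) :
    IsActionMinimizing ((fun y => y + a) ⁻¹' K) T (fun t => γ t - a) := by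
  refine ⟨h.1.translate a, fun T' β hβ => ?_⟩
  have hback := hβ.translate (-a)
  have hK : (fun y => y + -a) ⁻¹' ((fun y => y + a) ⁻¹' K) = K := by
    ext y
    simp only [mem_preimage, neg_add_cancel_right]
  rw [hK] at hback
  rw [h.1.action_translate, ← hβ.action_translate (-a)]
  exact h.2 T' _ hback

theorem IsActionMinimizing.ae_isIsotropic (h : IsActionMinimizing K T γ) (hconv : Convex ℝ K)
    (hcomp : IsCompact K) (hint : (interior K).Nonempty) :
    ∀ᵐ t, t ∈ Icc 0 T → IsIsotropic
      (Submodule.span ℝ (faceDirections (normalCone K (γ t)) (normalVelocity T γ t))) := by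
  obtain ⟨a, ha⟩ := hint
  have hnhds : (fun y => y + a) ⁻¹' K ∈ 𝓝 0 :=
    (continuous_add_const a).continuousAt.preimage_mem_nhds
      (by rwa [zero_add, ← mem_interior_iff_mem_nhds])
  have hcomp' : IsCompact ((fun y => y + a) ⁻¹' K) :=
    (Homeomorph.addRight a).isCompact_preimage.2 hcomp
  simpa only [normalCone_preimage_add, normalVelocity_translate] using
    (h.translate a).ae_isIsotropic_of_mem_nhds (hconv.translate_preimage_left a) hcomp' hnhds

end minimizing

/-! ### The classification -/

section classification

variable {K : Set (PhaseSpace n)} {T : ℝ} {γ : ℝ → PhaseSpace n}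

theorem isExtremeRay_minimalFace_or_one_lt_finrank {x v : PhaseSpace n} (hv : v ∈ normalCone K x)
    (hv0 : v ≠ 0) : IsExtremeRay (normalCone K x) (minimalFace (normalCone K x) v) ∨
      1 < Module.finrank ℝ (Submodule.span ℝ (faceDirections (normalCone K x) v)) := by
  rw [isExtremeRay_minimalFace_iff hv, eq_comm, ← le_iff_eq_or_lt, Submodule.one_le_finrank_iff]
  have hmem := Submodule.subset_span (R := ℝ)
    (self_mem_faceDirections (C := normalPointedCone K x) hv)
  exact Submodule.ne_bot_iff _ |>.2 ⟨v, hmem, hv0⟩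

theorem isOpen_setOf_movesAlong (K : Set (PhaseSpace n)) (T : ℝ) (γ : ℝ → PhaseSpace n) :
    IsOpen {t | ∃ F, IsCoisotropicFace K F ∧ MovesAlong K T γ F t} := by
  rw [isOpen_iff_mem_nhds]
  rintro t ⟨F, hF, t₀, t₁, ht, hmoves⟩
  filter_upwards [Ioo_mem_nhds ht.1 ht.2] with s hs
  exact ⟨F, hF, t₀, t₁, hs, hmoves⟩

theorem IsClosedCharacteristic.nullMeasurableSet_setOf_one_lt_finrank
    (h : IsClosedCharacteristic K T γ) :
    NullMeasurableSet {t | t ∈ Ioo 0 T ∧ normalVelocity T γ t ≠ 0 ∧ 1 < Module.finrank ℝ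
      (Submodule.span ℝ (faceDirections (normalCone K (γ t)) (normalVelocity T γ t)))} := by
  obtain ⟨p, hpm, -, hp⟩ := h.exists_dense_measurable_faceDirections
  have hvm := measurable_normalVelocity T γ
  have hmeas : MeasurableSet (Ioo 0 T ∩ {t | ∃ i, ‖inner ℝ (normalVelocity T γ t) (p i t)‖ ≠
      ‖normalVelocity T γ t‖ * ‖p i t‖}) := by
    rw [ofPred_exists]
    exact measurableSet_Ioo.inter <| .iUnion fun i =>
      (measurableSet_eq_fun (hvm.inner (hpm i)).norm (hvm.norm.mul (hpm i).norm)).compl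
  refine hmeas.nullMeasurableSet.congr ?_
  filter_upwards [hp, h.normalVelocity_mem_normalCone] with t hpt hNt
  refine propext (and_congr_right fun ht => ?_)
  obtain ⟨hmem, hdense⟩ := hpt (Ioo_subset_Icc_self ht)
  have hiff := one_lt_finrank_span_faceDirections_iff (C := normalPointedCone K (γ t))
    (hNt (Ioo_subset_Icc_self ht))
  constructor
  · rintro ⟨i, hi⟩
    have hv0 : normalVelocity T γ t ≠ 0 := fun hv0 => hi (by simp [hv0])
    exact ⟨hv0, (hiff hv0).2 ⟨p i t, hmem i, hi⟩⟩
  · rintro ⟨hv0, hdim⟩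
    obtain ⟨w, hw, hne⟩ := (hiff hv0).1 hdim
    have hopen : IsOpen {w | ‖inner ℝ (normalVelocity T γ t) w‖ ≠ ‖normalVelocity T γ t‖ * ‖w‖} :=
      isOpen_ne_fun (by fun_prop) (by fun_prop)
    obtain ⟨_, hne', i, rfl⟩ := mem_closure_iff.1 (hdense hw) _ hopen hne
    exact ⟨i, hne'⟩

/-- The interior times at which the velocity is nonzero and its minimal face is isotropic of
dimension greater than one, but `γ` moves along no coisotropic face: the candidate for an isotropic
gliding set, which may be a null set. -/
def glidingTimes (K : Set (PhaseSpace n)) (T : ℝ) (γ : ℝ → PhaseSpace n) : Set ℝ :=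
  {t | (t ∈ Ioo 0 T ∧ normalVelocity T γ t ≠ 0 ∧ 1 < Module.finrank ℝ
      (Submodule.span ℝ (faceDirections (normalCone K (γ t)) (normalVelocity T γ t)))) ∧
    (¬∃ F, IsCoisotropicFace K F ∧ MovesAlong K T γ F t) ∧
    normalVelocity T γ t ∈ normalCone K (γ t) ∧ IsIsotropic
      (Submodule.span ℝ (faceDirections (normalCone K (γ t)) (normalVelocity T γ t)))}

namespace IsActionMinimizing

theorem nullMeasurableSet_glidingTimes (hγ : IsActionMinimizing K T γ) (hconv : Convex ℝ K)
    (hcomp : IsCompact K) (hint : (interior K).Nonempty) :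
    NullMeasurableSet (glidingTimes K T γ) := by
  refine (hγ.1.nullMeasurableSet_setOf_one_lt_finrank.diff
    (isOpen_setOf_movesAlong K T γ).measurableSet.nullMeasurableSet).congr ?_
  filter_upwards [hγ.1.normalVelocity_mem_normalCone, hγ.ae_isIsotropic hconv hcomp hint]
    with t hNt hiso
  refine propext (and_congr_right fun ht => (and_iff_left ?_).symm)
  exact ⟨hNt (Ioo_subset_Icc_self ht.1), hiso (Ioo_subset_Icc_self ht.1)⟩

theorem isIsotropicGlidingSet_glidingTimes (hγ : IsActionMinimizing K T γ) (hconv : Convex ℝ K)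
    (hcomp : IsCompact K) (hint : (interior K).Nonempty) (hpos : 0 < volume (glidingTimes K T γ)) :
    IsIsotropicGlidingSet K T γ (glidingTimes K T γ) where
  subset _ ht := ht.1.1
  measurable := hγ.nullMeasurableSet_glidingTimes hconv hcomp hint
  pos := hpos
  isotropic := by
    rintro t ⟨⟨ht, -, hdim⟩, -, hv, hiso⟩
    have hspan := span_minimalFace (C := normalPointedCone K (γ t)) hv
    rw [coe_normalPointedCone] at hspan
    rw [← hspan] at hdim hiso
    refine ⟨_, isExtremeFace_minimalFace hv, hiso, hdim, ?_⟩
    rw [← normalVelocity_of_mem (Ioo_subset_Icc_self ht)]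
    exact self_mem_intrinsicInterior_minimalFace (C := normalPointedCone K (γ t)) hv
  not_movesAlong _ ht F hF hmoves := ht.2.1 ⟨F, hF, hmoves⟩

theorem ae_glidingTimes (hγ : IsActionMinimizing K T γ) (hconv : Convex ℝ K)
    (hcomp : IsCompact K) (hint : (interior K).Nonempty) :
    ∀ᵐ t, t ∈ glidingTimes K T γ → IsIsotropicGlidingSet K T γ (glidingTimes K T γ) := by
  rcases eq_zero_or_pos (volume (glidingTimes K T γ)) with hzero | hpos
  · filter_upwards [measure_eq_zero_iff_ae_notMem.1 hzero] with t hnot ht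
    exact absurd ht hnot
  · exact ae_of_all _ fun t _ => hγ.isIsotropicGlidingSet_glidingTimes hconv hcomp hint hpos

end IsActionMinimizing

end classification

end PhaseSpace

theorem mainTheorem4 (n : ℕ) (K : Set (PhaseSpace n)) (hconv : Convex ℝ K) (hcomp : IsCompact K)
    (hint : (interior K).Nonempty) (T : ℝ) (γ : ℝ → PhaseSpace n)
    (hγ : PhaseSpace.IsActionMinimizing K T γ) :
    ∀ᵐ t ∂MeasureTheory.volume.restrict (Set.Icc 0 T),
      (∃ R, PhaseSpace.IsExtremeRay (PhaseSpace.normalCone K (γ t)) R ∧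
        -PhaseSpace.J (deriv γ t) ∈ R) ∨
      (∃ E, PhaseSpace.IsCoisotropicFace K E ∧ PhaseSpace.MovesAlong K T γ E t) ∨
      (∃ A, PhaseSpace.IsIsotropicGlidingSet K T γ A ∧ t ∈ A) := by
  open PhaseSpace in
  refine (ae_restrict_iff' measurableSet_Icc).2 ?_
  filter_upwards [hγ.1.normalVelocity_mem_normalCone, hγ.ae_isIsotropic hconv hcomp hint,
    hγ.ae_glidingTimes hconv hcomp hint, Measure.ae_ne volume 0, Measure.ae_ne volume T]
    with t hv hiso hglide ht0 htT ht
  rw [← normalVelocity_of_mem ht]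
  rcases eq_or_ne (normalVelocity T γ t) 0 with hv0 | hv0
  · obtain ⟨R, hR, hzero⟩ := exists_isExtremeRay hconv hint (hγ.1.mem_boundary t ht)
    exact Or.inl ⟨R, hR, hv0 ▸ hzero⟩
  rcases isExtremeRay_minimalFace_or_one_lt_finrank (hv ht) hv0 with hray | hdim
  · exact Or.inl ⟨_, hray, self_mem_minimalFace (C := normalPointedCone K (γ t)) (hv ht)⟩
  by_cases hmoves : ∃ E, IsCoisotropicFace K E ∧ MovesAlong K T γ E t
  · exact Or.inr (Or.inl hmoves)
  have htIoo : t ∈ Ioo 0 T := ⟨ht.1.lt_of_ne' ht0, ht.2.lt_of_ne htT⟩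
  have hmem : t ∈ glidingTimes K T γ := ⟨⟨htIoo, hv0, hdim⟩, hmoves, hv ht, hiso ht⟩
  exact Or.inr (Or.inr ⟨_, hglide hmem, hmem⟩)
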